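/- Let $k$ be a field and let $X$ be a finite nonempty poset with incidence algebra $\Lambda$ over $k$, that is, the $k$-algebra with basis $\{c_{a,b} : a\le b \text{ in } X\}$ and multiplication $c_{a,b}c_{b',c}=\delta_{b,b'}\,c_{a,c}$. Let $\mathrm{HH}^i(\Lambda,\Lambda)=\mathrm{Ext}^i_{\Lambda\otimes_k\Lambda^{op}}(\Lambda,\Lambda)$ be its Hochschild cohomology. Let $X^*=X\cup\{x^*,y^*\}$, where $x^*,y^*\notin X$ and $x^*<x<y^*$ for all $x\in X$. For $z\in X^*$ write $z^+$ and $z^-$ for the sets of immediate successors and immediate predecessors of $z$ in $X^*$, and for a set $L$ let $kL$ be the vector space with basis $L$. Define sets $C^i$ and linear maps $\partial_i:kC^i\to kC^{i-1}$ as follows. Put $C^0=\{x^*\}$, $C^1=\{(x^*,y): y\in (x^*)^+\}$ and $\partial_1(x^*,y)=x^*$. For $i\ge 1$ and $z\in X^*$ let $(\ker\partial_i)_z$ be the subspace of those $w\in\ker\partial_i$ such that every element $(w',z')\in C^i$ of the support of $w$ satisfies $z'<z$; let $(\ker\partial_i)_{z^-}=\sum_{z'\in z^-}(\ker\partial_i)_{z'}$;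 choose any basis ${B^{i+1}_z}'$ of any complement of $(\ker\partial_i)_{z^-}$ in $(\ker\partial_i)_z$; and put $B^{i+1}_z=\{(w,z): w\in {B^{i+1}_z}'\}$, $C^{i+1}=\bigcup_{z\in X^*}B^{i+1}_z$, and $\partial_{i+1}(w,z)=w$. Then, whatever choices are made, the sets $B^{i+2}_{y^*}$ $(i\ge 0)$ are finite, the spaces $\mathrm{HH}^i(\Lambda,\Lambda)$ $(i\ge 0)$ are finite-dimensional over $k$, and $$\dim_k\mathrm{HH}^i(\Lambda,\Lambda)=\begin{cases}|B^2_{y^*}|+1,& i=0,\\ |B^{i+2}_{y^*}|,& i>0.\end{cases}$$ Moreover $|B^2_{y^*}|+1$ is the number of connected components of (the Hasse diagram of) $X$. -/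

import Mathlib

open scoped TensorProduct

universe u v

/-! ### Hochschild cohomology -/

section Hochschild

variable (k : Type u) [Field k] (A : Type v) [Ring A] [Algebra k A]

/-- The regular `A`-bimodule `A` over the `k`-algebra `A`, as a module over the enveloping algebra
`A ⊗[k] Aᵐᵒᵖ`. The action is `(a ⊗ op b) • m = a * m * b`. -/
noncomputable def regularBimodule : ModuleCat.{v} (A ⊗[k] Aᵐᵒᵖ) :=
  letI : Module (A ⊗[k] Aᵐᵒᵖ) A := TensorProduct.Algebra.module
  ModuleCat.of (A ⊗[k] Aᵐᵒᵖ) A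

end Hochschild

section HochschildGroups

variable (k : Type u) [Field k] (A : Type (max u v)) [Ring A] [Algebra k A]

/-- The Hochschild cohomology group `HHⁱ(A, A)` of the `k`-algebra `A` with coefficients in `A`:
the `i`-th `Ext` group of the bimodule `A` with itself, over the enveloping algebra. -/
def HochschildCohomology (i : ℕ) : Type (max u v) :=
  CategoryTheory.Abelian.Ext (regularBimodule.{u, max u v} k A) (regularBimodule k A) i

noncomputable instance (i : ℕ) : AddCommGroup (HochschildCohomology.{u, v} k A i) :=
  inferInstanceAs (AddCommGroup
    (CategoryTheory.Abelian.Ext (regularBimodule.{u, max u v} k A) (regularBimodule k A) i))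

/-- The `k`-vector space structure on Hochschild cohomology, coming from the `k`-linear structure
of the category of modules over the `k`-algebra `A ⊗[k] Aᵐᵒᵖ`. -/
noncomputable instance (i : ℕ) : Module k (HochschildCohomology.{u, v} k A i) :=
  letI : CategoryTheory.Linear k (ModuleCat.{max u v} (A ⊗[k] Aᵐᵒᵖ)) :=
    ModuleCat.Algebra.instLinear
  inferInstanceAs (Module k
    (CategoryTheory.Abelian.Ext (regularBimodule.{u, max u v} k A) (regularBimodule k A) i))

end HochschildGroups

/-! ### The cycles of a poset at a point -/

/-- The poset `X* = X ∪ {x*, y*}`, with a new minimum `x* = ⊥` and a new maximum `y* = ⊤`. -/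
abbrev StarPoset (X : Type v) : Type v := WithBot (WithTop X)

/-- One step `∂ : kC → kD` of the complex of cycles: `C` is the set of `i`-cycles, `D` the set of
`(i-1)`-cycles, and `top (w, z) = z` is the vertex at which a cycle ends. -/
structure CycleStage (k : Type u) [Field k] (P : Type v) where
  /-- the `i`-cycles -/
  C : Type (max u v)
  /-- the `(i-1)`-cycles -/
  D : Type (max u v)
  /-- the map `∂ᵢ` -/
  bd : (C →₀ k) →ₗ[k] (D →₀ k)
  /-- the end vertex of an `i`-cycle -/
  top : C → P

namespace CycleStage

variable {k : Type u} [Field k] {P : Type v}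

/-- The subspace `(ker ∂)_z` of those `w ∈ ker ∂` such that every cycle in the support of `w` ends
at a vertex `< z`. -/
noncomputable def kerAt [PartialOrder P] (S : CycleStage k P) (z : P) : Submodule k (S.C →₀ k) :=
  LinearMap.ker S.bd ⊓ Finsupp.supported k k {c | S.top c < z}

theorem mem_kerAt [PartialOrder P] (S : CycleStage k P) (z : P) (w : S.C →₀ k) :
    w ∈ S.kerAt z ↔ S.bd w = 0 ∧ ∀ c ∈ w.support, S.top c < z :=
  Iff.rfl

/-- The subspace `(ker ∂)_{z⁻}`, the sum of the `(ker ∂)_{z'}` over the immediate predecessors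
`z'` of `z`. -/
noncomputable def kerPred [PartialOrder P] (S : CycleStage k P) (z : P) : Submodule k (S.C →₀ k) :=
  ⨆ z' : P, ⨆ _ : z' ⋖ z, S.kerAt z'

theorem kerPred_le [PartialOrder P] (S : CycleStage k P) (z : P) : S.kerPred z ≤ S.kerAt z :=
  iSup₂_le fun _ hz => inf_le_inf_left _
    (Finsupp.supported_mono fun _ hc => lt_trans hc hz.lt)

/-- `B` is a basis of a complement of `(ker ∂)_{z⁻}` in `(ker ∂)_z`. -/
structure IsComplementBasis [PartialOrder P] (S : CycleStage k P) (z : P)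
    (B : Set (S.C →₀ k)) : Prop where
  linearIndependent : LinearIndependent k ((↑) : B → (S.C →₀ k))
  disjoint : Disjoint (S.kerPred z) (Submodule.span k B)
  sup_eq : S.kerPred z ⊔ Submodule.span k B = S.kerAt z

theorem exists_isComplementBasis [PartialOrder P] (S : CycleStage k P) (z : P) :
    ∃ B : Set (S.C →₀ k), S.IsComplementBasis z B := by
  obtain ⟨q, hd, hs⟩ := IsModularLattice.exists_disjoint_and_sup_eq (S.kerPred_le z)
  obtain ⟨b, -, hspan, hli⟩ := exists_linearIndependent k (q : Set (S.C →₀ k))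
  rw [Submodule.span_eq] at hspan
  exact ⟨b, hli, by rwa [hspan], by rwa [hspan]⟩

/-- The next step: given the sets `B z` for every vertex `z`, the new cycles are the pairs
`(w, z)` with `w ∈ B z`, and the new map sends the basis element `(w, z)` to `w`. -/
noncomputable def next (S : CycleStage k P) (B : P → Set (S.C →₀ k)) : CycleStage k P where
  C := {p : (S.C →₀ k) × P // p.1 ∈ B p.2}
  D := S.C
  bd := Finsupp.linearCombination k fun p => p.1.1
  top := fun p => p.1.2

/-- The starting step `∂₀ : kC⁰ → kC⁻¹`, with `C⁰ = {x}` and `kC⁻¹ = 0`. -/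
noncomputable def initial (k : Type u) [Field k] {P : Type v} (x : P) : CycleStage k P where
  C := ULift.{u} ({x} : Set P)
  D := PEmpty
  bd := 0
  top := fun c => c.down.1

end CycleStage

/-- The choices made in the construction of the cycles: at each step, for every vertex `z`, a basis
of a complement of `(ker ∂)_{z⁻}` in `(ker ∂)_z`. -/
structure BasisChoice (k : Type u) [Field k] (P : Type v) [PartialOrder P] where
  /-- the chosen basis of a complement -/
  basis : ∀ (_ : ℕ) (S : CycleStage k P) (_ : P), Set (S.C →₀ k)
  isComplementBasis : ∀ (n : ℕ) (S : CycleStage k P) (z : P),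
    S.IsComplementBasis z (basis n S z)

instance (k : Type u) [Field k] (P : Type v) [PartialOrder P] : Nonempty (BasisChoice k P) := by
  choose B hB using fun (S : CycleStage k P) (z : P) => S.exists_isComplementBasis z
  exact ⟨⟨fun _ => B, fun _ => hB⟩⟩

namespace BasisChoice

variable {k : Type u} [Field k] {P : Type v} [PartialOrder P]

/-- The step `∂ₙ : kCⁿ → kCⁿ⁻¹` of the complex of cycles of `P` at `x`. Here `C⁰ = {x}`,
`C¹ = {(x, y) | y ∈ x⁺}` and, for `n ≥ 1`, `Cⁿ⁺¹` is the set of pairs `(w, z)` with `w` in the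
chosen basis of a complement of `(ker ∂ₙ)_{z⁻}` in `(ker ∂ₙ)_z`. -/
noncomputable def stage (β : BasisChoice k P) (x : P) : ℕ → CycleStage k P
  | 0 => CycleStage.initial k x
  | 1 => (CycleStage.initial k x).next fun y =>
      {w | x ⋖ y ∧ w = Finsupp.single ⟨x, rfl⟩ 1}
  | n + 2 => (stage β x (n + 1)).next (β.basis (n + 1) (stage β x (n + 1)))

/-- The set `Bⁿ_z` of those `n`-cycles of `P` at `x` that end at `z`; for `n ≥ 2` it consists of
the pairs `(w, z)` with `w` in the basis chosen for the vertex `z`. -/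
def cyclesAt (β : BasisChoice k P) (x : P) (n : ℕ) (z : P) : Set (β.stage x n).C :=
  {c | (β.stage x n).top c = z}

end BasisChoice

/-! The idea is to resolve the regular bimodule `Λ` by bimodules built from the cycles, and to read
off `Ext(Λ, Λ)` from that resolution.

An increasing family `F b` of subspaces of a vector space, indexed by `b ∈ X`, gives a `Λ`-bimodule
with `F b` in position `(a, b)` for `a ≤ b` and zero elsewhere, and this construction is exact.
Apply it to the cycle spaces `(ker ∂ₙ)_b`, and let `Zₙ` be the resulting bimodule
(`BasisChoice.kerSystem`); then `Z₀` is `Λ` (`BasisChoice.kerSystemZeroIso`). The choice of bases of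
complements says exactly that the cycles ending at vertices `≤ b` generate the cycle space at `b`,
and that the relations among them only involve cycles ending strictly before `b`. So there are exact
sequences `0 → Zₙ₊₁ → Qₙ₊₁ → Zₙ → 0`, where `Qₙ₊₁` is the bimodule generated by the `(n + 1)`-cycles
that end in `X` (`BasisChoice.shortExact`).

In general the `Qₙ` are not projective, but they are acyclic for `Ext(-, Λ)`
(`ChainComplexOver.subsingleton_ext`). Indeed `Q`, a direct sum of bimodules with one generator `c`
ending at `t`, has a bar resolution by chains `x₁ ≤ … ≤ xₘ` in `[a, b]` lying above `t`, and a
cochain with values in `Λ` does not see `a`, as all nonzero entries of `Λ` are the same field. One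
may therefore replace `a` by `t`, and then cone with apex `t`.

Dimension shifting (`exists_linearMap_ext_of_acyclic`) identifies `Extⁿ⁺¹(Λ, Λ)` with the space of
maps `Zₙ₊₁ → Λ` modulo the maps that extend to `Qₙ₊₁`. A map `Zₙ → Λ` is a compatible family of
functionals on the `(ker ∂ₙ)_b`; composed with `∂ₙ₊₁` it becomes a functional on the span of the
`(n + 1)`-cycles ending in `X`. Restricted to `(ker ∂ₙ₊₁)_{y*}`, it vanishes on `(ker ∂ₙ₊₁)_{y*⁻}`.
All functionals on the quotient arise (`BasisChoice.exists_functionalOfHom_eq`), and the restriction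
is zero if and only if the family is the restriction of a single functional on `kCⁿ`
(`BasisChoice.functionalOfHom_eq_zero_iff`). For `n > 0` these are the maps that extend to `Qₙ`, and
so `Extⁿ(Λ, Λ)` is dual to a complement of `(ker ∂ₙ₊₁)_{y*⁻}` in `(ker ∂ₙ₊₁)_{y*}`, with basis
`Bⁿ⁺²_{y*}`. For `n = 0` the single functionals form a line, which accounts for the summand `1`; on
the other hand `Hom(Λ, Λ)` is the space of functions on `X` that are constant on connected
components (`BasisChoice.nonempty_hom_equiv_components`).
-/

set_option linter.unusedSectionVars false

/-! ### Dimension shifting and functoriality of Ext -/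

section Ext

open CategoryTheory Abelian

/-- Dimension shifting along a resolution `… → E 1 → E 0 → K 0` with syzygies `K n` whose terms are
acyclic for `Ext(-, N)`: iterated connecting maps present `Extⁱ⁺¹(K 0, N)` as the quotient of
`Hom(K (i + 1), N)` by the maps that factor through `K (i + 1) ⟶ E i`. -/
theorem exists_linearMap_ext_of_acyclic {R : Type*} [CommRing R] {C : Type*} [Category* C]
    [Abelian C] [Linear R C] [HasExt.{v} C] {N : C} (i : ℕ) (K E : ℕ → C) (f : ∀ n, K (n + 1) ⟶ E n)
    (g : ∀ n, E n ⟶ K n) (w : ∀ n, f n ≫ g n = 0)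
    (hS : ∀ n, (ShortComplex.mk (f n) (g n) (w n)).ShortExact)
    (hE : ∀ n j, Subsingleton (Ext.{v} (E n) N (j + 1))) :
    ∃ δ : (K (i + 1) ⟶ N) →ₗ[R] Ext.{v} (K 0) N (i + 1), Function.Surjective δ ∧
      ∀ φ, δ φ = 0 ↔ ∃ ψ : E i ⟶ N, f i ≫ ψ = φ := by
  induction i generalizing K E with
  | zero =>
    refine ⟨(Ext.precompOfLinear (hS 0).extClass R N (a := 0) (b := 1) rfl) ∘ₗ
      (Ext.linearEquiv₀ (R := R)).symm.toLinearMap, fun x => ?_, fun φ => ?_⟩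
    · obtain ⟨y, hy⟩ := Ext.contravariant_sequence_exact₃ (hS 0) N x
        (@Subsingleton.elim _ (hE 0 0) _ _) (n₀ := 0) rfl
      exact ⟨Ext.linearEquiv₀ (R := R) y, by simpa using hy⟩
    · constructor
      · intro h
        obtain ⟨y, hy⟩ := Ext.contravariant_sequence_exact₁ (hS 0) N (Ext.mk₀ φ) (n₁ := 1) rfl
          (by simpa using h)
        obtain ⟨ψ, rfl⟩ := (Ext.linearEquiv₀ (R := R)).symm.surjective y
        refine ⟨ψ, ?_⟩
        apply (Ext.linearEquiv₀ (R := R)).symm.injective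
        simpa using hy
      · rintro ⟨ψ, rfl⟩
        simp only [LinearMap.comp_apply, LinearEquiv.coe_coe, Ext.linearEquiv₀_symm_apply]
        rw [← Ext.mk₀_comp_mk₀]
        change (hS 0).extClass.comp _ (rfl : 1 + 0 = 1) = 0
        exact ShortComplex.ShortExact.extClass_comp_assoc (hS 0) _ (h := rfl)
  | succ i ih =>
    obtain ⟨δ, hδ, hδ'⟩ := ih (fun n => K (n + 1)) (fun n => E (n + 1)) (fun n => f (n + 1))
      (fun n => g (n + 1)) (fun n => w (n + 1)) (fun n => hS (n + 1)) (fun n => hE (n + 1))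
    refine ⟨(Ext.precompOfLinear (hS 0).extClass R N (a := i + 1) (b := i + 2) (by lia)) ∘ₗ δ,
      fun x => ?_, fun φ => ?_⟩
    · obtain ⟨y, hy⟩ := Ext.contravariant_sequence_exact₃ (hS 0) N x
        (@Subsingleton.elim _ (hE 0 _) _ _) (n₀ := i + 1) (by lia)
      obtain ⟨z, rfl⟩ := hδ y
      exact ⟨z, hy⟩
    · rw [← hδ']
      refine ⟨fun h => ?_, fun h => by simp [h]⟩
      obtain ⟨y, hy⟩ := Ext.contravariant_sequence_exact₁ (hS 0) N (δ φ) (n₁ := i + 2) (by lia) h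
      rw [← hy, @Subsingleton.elim _ (hE 0 _) y 0, Ext.comp_zero]

namespace CategoryTheory.Abelian.Ext

theorem nonempty_linearEquiv_of_iso {R : Type*} [CommRing R] {C : Type*} [Category* C] [Abelian C]
    [Linear R C] [HasExt.{v} C] {M M' N N' : C} (e : M ≅ M') (e' : N ≅ N') (i : ℕ) :
    Nonempty (Ext.{v} M N i ≃ₗ[R] Ext.{v} M' N' i) := by
  let f : Ext.{v} M N i →ₗ[R] Ext.{v} M' N' i :=
    precompOfLinear (mk₀ e.inv) R N' (zero_add i) ∘ₗ postcompOfLinear (mk₀ e'.hom) R M (add_zero i)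
  let g : Ext.{v} M' N' i →ₗ[R] Ext.{v} M N i :=
    precompOfLinear (mk₀ e.hom) R N (zero_add i) ∘ₗ postcompOfLinear (mk₀ e'.inv) R M' (add_zero i)
  refine ⟨LinearEquiv.ofLinearMap f g (LinearMap.ext fun x => ?_) (LinearMap.ext fun x => ?_)⟩
  · simp [f, g]
  · simp [f, g]

end CategoryTheory.Abelian.Ext

end Ext

/-! ### Linear algebra -/

/-- Two linear maps that agree on the basis vectors of `s` agree on the vectors supported in `s`. -/
theorem Finsupp.eq_of_mem_supported {k ι V : Type*} [Field k] [AddCommGroup V] [Module k V]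
    {f g : (ι →₀ k) →ₗ[k] V} {s : Set ι} (h : ∀ j ∈ s, f (single j 1) = g (single j 1))
    {w : ι →₀ k} (hw : w ∈ supported k k s) : f w = g w := by
  rw [← Finsupp.sum_single w, map_finsuppSum, map_finsuppSum]
  refine Finsupp.sum_congr fun j hj => ?_
  rw [← mul_one (w j), ← smul_eq_mul, ← Finsupp.smul_single, map_smul, map_smul, h j (hw hj)]

/-- A functional that vanishes on `p ∩ ker T` factors through `T` on `p`. -/
theorem LinearMap.exists_dual_comp_eq {k V W : Type*} [Field k] [AddCommGroup V] [Module k V]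
    [AddCommGroup W] [Module k W] (p : Submodule k V) (T : V →ₗ[k] W) (θ : V →ₗ[k] k)
    (h : ∀ w ∈ p, T w = 0 → θ w = 0) : ∃ η : W →ₗ[k] k, ∀ w ∈ p, η (T w) = θ w := by
  have hθ : θ.domRestrict p ∈ (LinearMap.ker (T.domRestrict p)).dualAnnihilator := by
    rw [Submodule.mem_dualAnnihilator]
    exact fun w hw => h w.1 w.2 hw
  rw [← LinearMap.range_dualMap_eq_dualAnnihilator_ker] at hθ
  obtain ⟨η, hη⟩ := hθ
  exact ⟨η, fun w hw => LinearMap.congr_fun hη ⟨w, hw⟩⟩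

theorem Submodule.exists_dual_extend_of_disjoint {k V : Type*} [Field k] [AddCommGroup V]
    [Module k V] {p q : Submodule k V} (h : Disjoint p q) (lam : q →ₗ[k] k) :
    ∃ θ : V →ₗ[k] k, (∀ w ∈ p, θ w = 0) ∧ ∀ w : q, θ w.1 = lam w := by
  have hq : Function.Injective (p.mkQ.domRestrict q) :=
    (injective_iff_map_eq_zero _).2 fun w hw =>
      Subtype.ext (Submodule.disjoint_def.1 h _ ((Submodule.Quotient.mk_eq_zero _).1 hw) w.2)
  obtain ⟨μ, hμ⟩ := LinearMap.dualMap_surjective_of_injective hq lam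
  refine ⟨μ ∘ₗ p.mkQ, fun w hw => ?_, fun w => LinearMap.congr_fun hμ w⟩
  rw [LinearMap.comp_apply, Submodule.mkQ_apply, (Submodule.Quotient.mk_eq_zero _).2 hw, map_zero]

theorem LinearMap.nonempty_quotKer_equiv {k V W W' : Type*} [Field k] [AddCommGroup V] [Module k V]
    [AddCommGroup W] [Module k W] [AddCommGroup W'] [Module k W'] {f : V →ₗ[k] W} {g : V →ₗ[k] W'}
    (hf : Function.Surjective f) (hg : Function.Surjective g) (h : ∀ v, f v = 0 ↔ g v = 0) :
    Nonempty (W ≃ₗ[k] W') := by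
  have : LinearMap.ker f = LinearMap.ker g := Submodule.ext h
  exact ⟨(f.quotKerEquivOfSurjective hf).symm ≪≫ₗ Submodule.quotEquivOfEq _ _ this ≪≫ₗ
    g.quotKerEquivOfSurjective hg⟩

theorem finrank_dual_submodule {k V : Type*} [Field k] [AddCommGroup V] [Module k V]
    (p : Submodule k V) : Module.finrank k (Module.Dual k p) = Module.finrank k p :=
  Subspace.dual_finrank_eq

/-! ### Bimodules over the incidence algebra as spaces of matrices -/

section Bimodules

open MulOpposite

variable {k : Type u} [Field k] {X : Type v} {V W : Type*} [AddCommGroup V] [Module k V]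
  [AddCommGroup W] [Module k W]

/-- Matrices with rows and columns indexed by `X` and entries in a vector space `V`. The incidence
algebra `Λ` acts on them by matrix multiplication from both sides. This is not reducible to the
function type, so that these actions do not clash with the pointwise ones. -/
def BiMatrix (X V : Type*) := X → X → V

@[ext] theorem BiMatrix.ext {X V : Type*} {m n : BiMatrix X V} (h : ∀ a b, m a b = n a b) : m = n :=
  funext₂ h

namespace BiMatrix

instance : AddCommGroup (BiMatrix X V) := inferInstanceAs (AddCommGroup (X → X → V))

instance : Module k (BiMatrix X V) := inferInstanceAs (Module k (X → X → V))

@[simp] theorem zero_apply (a b : X) : (0 : BiMatrix X V) a b = 0 := rfl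

@[simp] theorem add_apply (m n : BiMatrix X V) (a b : X) : (m + n) a b = m a b + n a b :=
  rfl

@[simp] theorem smul_apply (r : k) (m : BiMatrix X V) (a b : X) :
    (r • m) a b = r • m a b := rfl

theorem sum_apply {ι : Type*} (s : Finset ι) (m : ι → BiMatrix X V) (a b : X) :
    (∑ i ∈ s, m i) a b = ∑ i ∈ s, m i a b := by
  induction s using Finset.cons_induction with
  | empty => rfl
  | cons i s hi ih => simp [Finset.sum_cons, ih]

variable [DecidableEq X]

/-- The matrix whose only nonzero entry is `w` at `(a, b)`. -/
def single (a b : X) (w : V) : BiMatrix X V := fun c d => if c = a ∧ d = b then w else 0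

theorem single_apply (a b : X) (w : V) (c d : X) :
    single a b w c d = if c = a ∧ d = b then w else 0 := rfl

@[simp] theorem single_apply_same (a b : X) (w : V) : single a b w a b = w := by
  simp [single]

variable [Fintype X]

theorem eq_sum_single (m : BiMatrix X V) : m = ∑ a, ∑ b, single a b (m a b) := by
  ext c d
  simp only [sum_apply, single_apply]
  rw [Finset.sum_eq_single c (by simp +contextual [eq_comm]) (by simp),
    Finset.sum_eq_single d (by simp +contextual [eq_comm]) (by simp)]
  simp

end BiMatrix

variable [PartialOrder X]

namespace IncidenceAlgebra

theorem mul_apply_eq_sum [LocallyFiniteOrder X] [Fintype X] (x y : IncidenceAlgebra k X) (a b : X) :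
    (x * y) a b = ∑ c, x a c * y c b := by
  rw [mul_apply]
  refine Finset.sum_subset (Finset.subset_univ _) fun c _ hc => ?_
  rw [Finset.mem_Icc, not_and_or] at hc
  rcases hc with h | h <;> simp [apply_eq_zero_of_not_le h]

variable (k) in
/-- The basis element `c_{p,q}`; it is zero unless `p ≤ q`. -/
noncomputable def unit (p q : X) : IncidenceAlgebra k X :=
  open Classical in ⟨fun a b => if p ≤ q ∧ a = p ∧ b = q then 1 else 0, fun _ _ hab =>
    if_neg fun ⟨h, ha, hb⟩ => hab (ha ▸ hb ▸ h)⟩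

theorem unit_apply [DecidableEq X] {p q : X} (h : p ≤ q) (a b : X) :
    unit k p q a b = if a = p ∧ b = q then 1 else 0 := by
  simp [unit, h]

variable [LocallyFiniteOrder X] [Fintype X] [DecidableEq X]

theorem mul_unit (x : IncidenceAlgebra k X) {p q : X} (h : p ≤ q) :
    x * unit k p q = ∑ a, x a p • unit k a q := by
  ext c d hcd
  rw [mul_apply_eq_sum]
  have : ∀ s : Finset X, (∑ a ∈ s, x a p • unit k a q) c d = ∑ a ∈ s, x a p * unit k a q c d := by
    intro s
    induction s using Finset.cons_induction with
    | empty => rfl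
    | cons i s hi ih => rw [Finset.sum_cons, Finset.sum_cons, ← ih]; rfl
  rw [this, Finset.sum_eq_single p (by simp +contextual [unit_apply h]) (by simp),
    Finset.sum_eq_single c ?_ (by simp)]
  · by_cases hcp : c ≤ p
    · simp [unit_apply h, unit_apply (hcp.trans h)]
    · simp [apply_eq_zero_of_not_le hcp]
  · intro b _ hb
    simp [unit, hb.symm]

theorem unit_mul (y : IncidenceAlgebra k X) {p q : X} (h : p ≤ q) :
    unit k p q * y = ∑ b, y q b • unit k p b := by
  ext c d hcd
  rw [mul_apply_eq_sum]
  have : ∀ s : Finset X, (∑ a ∈ s, y q a • unit k p a) c d = ∑ a ∈ s, y q a * unit k p a c d := by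
    intro s
    induction s using Finset.cons_induction with
    | empty => rfl
    | cons i s hi ih => rw [Finset.sum_cons, Finset.sum_cons, ← ih]; rfl
  rw [this, Finset.sum_eq_single q (by simp +contextual [unit_apply h]) (by simp),
    Finset.sum_eq_single d ?_ (by simp)]
  · by_cases hqd : q ≤ d
    · simp [unit_apply h, unit_apply (h.trans hqd)]
    · simp [apply_eq_zero_of_not_le hqd]
  · intro b _ hb
    simp [unit, hb.symm]

end IncidenceAlgebra

variable [LocallyFiniteOrder X] [DecidableEq X] [Fintype X]

namespace BiMatrix

noncomputable instance : Module (IncidenceAlgebra k X) (BiMatrix X V) where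
  smul x m := fun a b => ∑ c, x a c • m c b
  one_smul m := by
    ext a b
    change ∑ c, _ • _ = _
    simp [IncidenceAlgebra.one_apply]
  mul_smul x y m := by
    ext a b
    change ∑ c, _ • _ = ∑ c, _ • ∑ d, _ • _
    simp only [IncidenceAlgebra.mul_apply_eq_sum, Finset.sum_smul, Finset.smul_sum, mul_smul]
    exact Finset.sum_comm
  smul_zero x := by
    ext a b
    exact Finset.sum_eq_zero fun c _ => smul_zero _
  smul_add x m n := by
    ext a b
    exact (Finset.sum_congr rfl fun c _ => smul_add _ _ _).trans Finset.sum_add_distrib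
  add_smul x y m := by
    ext a b
    exact (Finset.sum_congr rfl fun c _ => add_smul _ _ _).trans Finset.sum_add_distrib
  zero_smul m := by
    ext a b
    exact Finset.sum_eq_zero fun c _ => zero_smul k _

theorem left_smul_apply (x : IncidenceAlgebra k X) (m : BiMatrix X V) (a b : X) :
    (x • m) a b = ∑ c, x a c • m c b := rfl

noncomputable instance : Module (IncidenceAlgebra k X)ᵐᵒᵖ (BiMatrix X V) where
  smul y m := fun a b => ∑ d, unop y d b • m a d
  one_smul m := by
    ext a b
    change ∑ c, _ • _ = _
    simp [IncidenceAlgebra.one_apply]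
  mul_smul x y m := by
    ext a b
    change ∑ c, _ • _ = ∑ c, _ • ∑ d, _ • _
    simp only [unop_mul, IncidenceAlgebra.mul_apply_eq_sum, Finset.sum_smul, Finset.smul_sum,
      ← mul_smul]
    rw [Finset.sum_comm]
    simp only [mul_comm]
  smul_zero x := by
    ext a b
    exact Finset.sum_eq_zero fun c _ => smul_zero _
  smul_add x m n := by
    ext a b
    exact (Finset.sum_congr rfl fun c _ => smul_add _ _ _).trans Finset.sum_add_distrib
  add_smul x y m := by
    ext a b
    exact (Finset.sum_congr rfl fun c _ => add_smul _ _ _).trans Finset.sum_add_distrib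
  zero_smul m := by
    ext a b
    exact Finset.sum_eq_zero fun c _ => zero_smul k _

theorem right_smul_apply (y : (IncidenceAlgebra k X)ᵐᵒᵖ) (m : BiMatrix X V) (a b : X) :
    (y • m) a b = ∑ d, unop y d b • m a d := rfl

instance : SMulCommClass (IncidenceAlgebra k X) (IncidenceAlgebra k X)ᵐᵒᵖ
    (BiMatrix X V) where
  smul_comm x y m := by
    ext a b
    simp only [left_smul_apply, right_smul_apply, Finset.smul_sum]
    rw [Finset.sum_comm]
    exact Finset.sum_congr rfl fun d _ => Finset.sum_congr rfl fun c _ => smul_comm _ _ _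

instance : IsScalarTower k (IncidenceAlgebra k X) (BiMatrix X V) where
  smul_assoc r x m := by
    ext a b
    change ∑ c, (r • x a c) • m c b = r • ∑ c, x a c • m c b
    simp only [Finset.smul_sum, smul_eq_mul, mul_smul]

instance : IsScalarTower k (IncidenceAlgebra k X)ᵐᵒᵖ (BiMatrix X V) where
  smul_assoc r x m := by
    ext a b
    change ∑ d, (r • unop x d b) • m a d = r • ∑ d, unop x d b • m a d
    simp only [Finset.smul_sum, smul_eq_mul, mul_smul]

end BiMatrix

variable (k X) in
/-- The enveloping algebra of the incidence algebra. -/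
abbrev EnvelopingAlgebra : Type (max u v) := IncidenceAlgebra k X ⊗[k] (IncidenceAlgebra k X)ᵐᵒᵖ

noncomputable instance : Ring (EnvelopingAlgebra.{u, v} k X) := inferInstance

namespace BiMatrix

noncomputable instance : Module (EnvelopingAlgebra k X)
    (BiMatrix X V) := TensorProduct.Algebra.module

instance : IsScalarTower k (EnvelopingAlgebra k X)
    (BiMatrix X V) where
  smul_assoc r x m := by
    change TensorProduct.Algebra.moduleAux _ _ = r • TensorProduct.Algebra.moduleAux _ _
    simp

theorem tmul_smul_apply (x : IncidenceAlgebra k X) (y : (IncidenceAlgebra k X)ᵐᵒᵖ)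
    (m : BiMatrix X V) (a b : X) :
    ((x ⊗ₜ[k] y) • m) a b = ∑ c, ∑ d, (x a c * unop y d b) • m c d := by
  change (x • y • m) a b = _
  simp only [left_smul_apply, right_smul_apply, Finset.smul_sum, mul_smul]

theorem unit_tmul_unit_smul {p a b q : X} (hp : p ≤ a) (hq : b ≤ q) (m : BiMatrix X V) :
    (IncidenceAlgebra.unit k p a ⊗ₜ[k] op (IncidenceAlgebra.unit k b q)) • m =
      single p q (m a b) := by
  ext c d
  rw [tmul_smul_apply, Finset.sum_eq_single a, Finset.sum_eq_single b]
  · by_cases hc : c = p <;> by_cases hd : d = q <;>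
      simp [IncidenceAlgebra.unit_apply hp, IncidenceAlgebra.unit_apply hq, single_apply, hc, hd]
  all_goals simp +contextual [IncidenceAlgebra.unit_apply hp, IncidenceAlgebra.unit_apply hq]

end BiMatrix

/-- An additive map that commutes with the action of pure tensors is linear over the tensor product
of two algebras. -/
def LinearMap.ofTmul {M N : Type*} [AddCommGroup M] [AddCommGroup N]
    {A B : Type*} [Ring A] [Algebra k A] [Ring B] [Algebra k B] [Module (A ⊗[k] B) M]
    [Module (A ⊗[k] B) N] (f : M →+ N)
    (h : ∀ (x : A) (y : B) (m : M), f ((x ⊗ₜ[k] y) • m) = (x ⊗ₜ[k] y) • f m) :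
    M →ₗ[A ⊗[k] B] N where
  __ := f
  map_smul' r m := by
    change f _ = r • f m
    induction r using TensorProduct.induction_on with
    | zero => simp
    | tmul x y => exact h x y m
    | add r s hr hs => rw [add_smul, add_smul, map_add, hr, hs]

variable (k X V) in
/-- A family of subspaces `E a b` of a fixed vector space `V`, one for each interval `[a, b]` of
`X`, growing with the interval. When `[a, b]` is empty, `E a b` is zero. Such a family is a
`Λ`-bimodule all of whose structure maps are inclusions. -/
structure IntervalSystem where
  /-- the subspace attached to the interval `[a, b]` -/
  carrier : X → X → Submodule k V
  mono : ∀ {a a' b b' : X}, a' ≤ a → b ≤ b' → carrier a b ≤ carrier a' b'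
  eq_bot : ∀ {a b : X}, ¬ a ≤ b → carrier a b = ⊥

namespace IntervalSystem

/-- The bimodule of an interval system `E`: the matrices whose `(a, b)` entry lies in `E a b`. -/
noncomputable def bimodule (E : IntervalSystem k X V) :
    Submodule (EnvelopingAlgebra k X) (BiMatrix X V) where
  carrier := {m | ∀ a b, m a b ∈ E.carrier a b}
  add_mem' hm hn a b := add_mem (hm a b) (hn a b)
  zero_mem' a b := zero_mem _
  smul_mem' r m hm := by
    induction r using TensorProduct.induction_on with
    | zero => intro a b; rw [zero_smul]; exact zero_mem _
    | add r s hr hs => intro a b; rw [add_smul]; exact add_mem (hr a b) (hs a b)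
    | tmul x y =>
      intro a b
      rw [BiMatrix.tmul_smul_apply]
      refine sum_mem fun c _ => sum_mem fun d _ => ?_
      by_cases hc : a ≤ c
      · by_cases hd : d ≤ b
        · exact Submodule.smul_mem _ _ (E.mono hc hd (hm c d))
        · simp [IncidenceAlgebra.apply_eq_zero_of_not_le hd]
      · simp [IncidenceAlgebra.apply_eq_zero_of_not_le hc]

noncomputable instance (E : IntervalSystem k X V) : AddCommGroup E.bimodule :=
  Submodule.addCommGroup _

noncomputable instance (E : IntervalSystem k X V) : Module (EnvelopingAlgebra k X) E.bimodule :=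
  Submodule.module _

variable {E : IntervalSystem k X V} {E' : IntervalSystem k X W}

@[ext] theorem bimodule_ext {m n : E.bimodule} (h : ∀ a b, m.1 a b = n.1 a b) : m = n :=
  Subtype.ext (BiMatrix.ext h)

theorem single_mem {a b : X} {w : V} (hw : w ∈ E.carrier a b) :
    BiMatrix.single a b w ∈ E.bimodule := by
  intro c d
  rw [BiMatrix.single_apply]
  split_ifs with h
  · rwa [h.1, h.2]
  · exact zero_mem _

variable (E) in
/-- The element of the bimodule whose only nonzero entry is `w` at `(a, b)`. -/
noncomputable def single (a b : X) : E.carrier a b →ₗ[k] E.bimodule where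
  toFun w := ⟨BiMatrix.single a b w.1, single_mem w.2⟩
  map_add' w w' := by ext c d; simp [BiMatrix.single_apply, ← ite_add_zero]
  map_smul' r w := by ext c d; simp [BiMatrix.single_apply]

theorem coe_single {a b : X} (w : E.carrier a b) :
    (E.single a b w : BiMatrix X V) = BiMatrix.single a b w.1 := rfl

/-- The bimodule map acting on the `(a, b)` entry by `φ a b`, for a family of linear maps that
agree on `E a b` whenever the interval `[a, b]` is enlarged. -/
noncomputable def map (E : IntervalSystem k X V) (E' : IntervalSystem k X W)
    (φ : X → X → V →ₗ[k] W)
    (hφ : ∀ a b, ∀ w ∈ E.carrier a b, φ a b w ∈ E'.carrier a b)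
    (hc : ∀ a a' b b', a' ≤ a → a ≤ b → b ≤ b' → ∀ w ∈ E.carrier a b, φ a' b' w = φ a b w) :
    E.bimodule →ₗ[EnvelopingAlgebra k X] E'.bimodule :=
  LinearMap.ofTmul
    { toFun := fun m => ⟨fun a b => φ a b (m.1 a b), fun a b => hφ a b _ (m.2 a b)⟩
      map_zero' := by ext a b; exact map_zero (φ a b)
      map_add' := fun m n => by ext a b; exact map_add (φ a b) _ _ } (by
    intro x y m
    ext a b
    let m' : BiMatrix X W := fun a b => φ a b (m.1 a b)
    change φ a b (((x ⊗ₜ[k] y) • m.1) a b) = ((x ⊗ₜ[k] y) • m') a b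
    simp only [BiMatrix.tmul_smul_apply, map_sum, map_smul]
    refine Finset.sum_congr rfl fun c _ => Finset.sum_congr rfl fun d _ => ?_
    by_cases h : c ≤ d
    · by_cases hc' : a ≤ c
      · by_cases hd : d ≤ b
        · rw [hc c a d b hc' h hd _ (m.2 c d)]
        · simp [IncidenceAlgebra.apply_eq_zero_of_not_le hd]
      · simp [IncidenceAlgebra.apply_eq_zero_of_not_le hc']
    · have := m.2 c d
      rw [E.eq_bot h, Submodule.mem_bot] at this
      simp [m', this])

/-- The bimodule map applying one linear map of the ambient spaces to all entries. -/
noncomputable def mapConst (E : IntervalSystem k X V) (E' : IntervalSystem k X W)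
    (f : V →ₗ[k] W) (hf : ∀ a b, ∀ w ∈ E.carrier a b, f w ∈ E'.carrier a b) :
    E.bimodule →ₗ[EnvelopingAlgebra k X] E'.bimodule :=
  map E E' (fun _ _ => f) hf fun _ _ _ _ _ _ _ _ _ => rfl

section Hom

variable (f : E.bimodule →ₗ[EnvelopingAlgebra k X] E'.bimodule)

/-- A bimodule map commutes with moving the entry of `m` at `(a, b)` to a larger interval, because
this move is multiplication by `c_{a',a} ⊗ c_{b,b'}`. -/
theorem hom_single_apply_of_le {a a' b b' : X} (ha : a' ≤ a) (hb : b ≤ b') (m : E.bimodule) :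
    (f (E.single a' b' ⟨m.1 a b, E.mono ha hb (m.2 a b)⟩)).1 a' b' = (f m).1 a b := by
  have : E.single a' b' ⟨m.1 a b, E.mono ha hb (m.2 a b)⟩ =
      (IncidenceAlgebra.unit k a' a ⊗ₜ[k] op (IncidenceAlgebra.unit k b b')) • m :=
    Subtype.ext (BiMatrix.unit_tmul_unit_smul ha hb m.1).symm
  rw [this, map_smul]
  change ((_ ⊗ₜ[k] _) • (f m).1) a' b' = _
  rw [BiMatrix.unit_tmul_unit_smul ha hb, BiMatrix.single_apply_same]

theorem hom_single_apply (m : E.bimodule) (a b : X) :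
    (f (E.single a b ⟨m.1 a b, m.2 a b⟩)).1 a b = (f m).1 a b :=
  hom_single_apply_of_le f le_rfl le_rfl m

theorem hom_single_compat {a a' b b' : X} (ha : a' ≤ a) (hb : b ≤ b') (w : V)
    (hw : w ∈ E.carrier a b) :
    (f (E.single a' b' ⟨w, E.mono ha hb hw⟩)).1 a' b' = (f (E.single a b ⟨w, hw⟩)).1 a b := by
  have h : (⟨w, E.mono ha hb hw⟩ : E.carrier a' b') =
      ⟨(E.single a b ⟨w, hw⟩).1 a b, E.mono ha hb ((E.single a b ⟨w, hw⟩).2 a b)⟩ :=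
    Subtype.ext (BiMatrix.single_apply_same ..).symm
  rw [h, hom_single_apply_of_le f ha hb]

end Hom

section Projective

variable {ι : Type*}

/-- A system whose `(a, b)` subspace is spanned by the basis vectors `j` with `a ≤ s j` and
`t j ≤ b` is a direct sum of the projective bimodules `Λ c_{s j, s j} ⊗ c_{t j, t j} Λ`. The proof
splits the surjection from the free module on `ι` that sends `j` to the entry `j` at
`(s j, t j)`. -/
theorem projective_of_carrier_eq_supported (E : IntervalSystem k X (ι →₀ k)) (p : ι → Prop)
    (s t : ι → X)
    (hE : ∀ a b, E.carrier a b = Finsupp.supported k k {j | p j ∧ a ≤ s j ∧ t j ≤ b}) :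
    Module.Projective (EnvelopingAlgebra k X) E.bimodule := by
  classical
  have hgen : ∀ j, p j → Finsupp.single j (1 : k) ∈ E.carrier (s j) (t j) := fun j hj => by
    rw [hE]
    exact Finsupp.single_mem_supported k _ ⟨hj, le_rfl, le_rfl⟩
  let gen : ι → E.bimodule := fun j =>
    if h : p j then E.single (s j) (t j) ⟨Finsupp.single j 1, hgen j h⟩ else 0
  let e : X → X → ι → EnvelopingAlgebra k X := fun a b j =>
    IncidenceAlgebra.unit k a (s j) ⊗ₜ[k] op (IncidenceAlgebra.unit k (t j) b)
  let L : X → X → (ι →₀ k) →ₗ[k] (ι →₀ EnvelopingAlgebra k X) := fun a b =>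
    Finsupp.linearCombination k fun j => Finsupp.single j (e a b j)
  have hL : ∀ a b j, L a b (Finsupp.single j 1) = Finsupp.single j (e a b j) := by simp [L]
  have he : ∀ (x : IncidenceAlgebra k X) (y : (IncidenceAlgebra k X)ᵐᵒᵖ) (c d : X) (j : ι),
      c ≤ s j → t j ≤ d →
      (x ⊗ₜ[k] y : EnvelopingAlgebra k X) * e c d j = ∑ a, ∑ b, (x a c * unop y d b) • e a b j := by
    intro x y c d j hc hd
    have hy : y * op (IncidenceAlgebra.unit k (t j) d) =
        ∑ b, unop y d b • op (IncidenceAlgebra.unit k (t j) b) := by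
      apply unop_injective
      simp [IncidenceAlgebra.unit_mul _ hd]
    simp only [e]
    rw [Algebra.TensorProduct.tmul_mul_tmul, hy, IncidenceAlgebra.mul_unit _ hc]
    simp only [TensorProduct.sum_tmul, TensorProduct.tmul_sum, TensorProduct.smul_tmul_smul]
    exact Finset.sum_comm
  have hsmul : ∀ (x : IncidenceAlgebra k X) (y : (IncidenceAlgebra k X)ᵐᵒᵖ) (c d : X)
      (w : ι →₀ k), w ∈ E.carrier c d →
      (x ⊗ₜ[k] y : EnvelopingAlgebra k X) • L c d w = ∑ a, ∑ b, (x a c * unop y d b) • L a b w := by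
    intro x y c d w hw
    rw [hE] at hw
    have := Finsupp.eq_of_mem_supported
      (f := (Algebra.lsmul k k (ι →₀ EnvelopingAlgebra k X)
        (x ⊗ₜ[k] y : EnvelopingAlgebra k X)) ∘ₗ L c d)
      (g := ∑ a, ∑ b, (x a c * unop y d b) • L a b) (fun j hj => ?_) hw
    · simpa [LinearMap.sum_apply] using this
    · simp only [LinearMap.comp_apply, hL, LinearMap.sum_apply, LinearMap.smul_apply,
        Algebra.lsmul_coe, Finsupp.smul_single, smul_eq_mul]
      rw [he x y c d j hj.2.1 hj.2.2, Finsupp.single_finsetSum]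
      simp only [Finsupp.single_finsetSum]
  -- the section writes the vector `j` in the entry `(a, b)` as `c_{a, s j} ⊗ c_{t j, b}` times
  -- the generator `j`
  let σ : E.bimodule →ₗ[EnvelopingAlgebra k X] (ι →₀ EnvelopingAlgebra k X) := LinearMap.ofTmul
    { toFun := fun m => ∑ a, ∑ b, L a b (m.1 a b)
      map_zero' := by simp
      map_add' := fun m n => by simp [Finset.sum_add_distrib] } (by
    intro x y m
    change ∑ a, ∑ b, L a b (((x ⊗ₜ[k] y) • m.1) a b) =
      (x ⊗ₜ[k] y : EnvelopingAlgebra k X) • ∑ c, ∑ d, L c d (m.1 c d)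
    simp only [Finset.smul_sum, hsmul _ _ _ _ _ (m.2 _ _), BiMatrix.tmul_smul_apply, map_sum,
      map_smul]
    rw [Finset.sum_congr rfl fun a _ => Finset.sum_comm, Finset.sum_comm]
    refine Finset.sum_congr rfl fun c _ => ?_
    rw [Finset.sum_congr rfl fun a _ => Finset.sum_comm, Finset.sum_comm])
  refine Module.Projective.of_split σ (Finsupp.linearCombination (EnvelopingAlgebra k X) gen) ?_
  ext1 m
  have hπ : ∀ a b, ∀ w (hw : w ∈ E.carrier a b),
      (Finsupp.linearCombination (EnvelopingAlgebra k X) gen (L a b w)).1 =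
        BiMatrix.single a b w := by
    intro a b w hw
    have hw' := hw
    rw [hE] at hw'
    let sg : (ι →₀ k) →ₗ[k] BiMatrix X (ι →₀ k) :=
      { toFun := BiMatrix.single a b
        map_add' := fun w w' => by ext1 c d; simp [BiMatrix.single_apply, ← ite_add_zero]
        map_smul' := fun r w => by ext1 c d; simp [BiMatrix.single_apply] }
    refine Finsupp.eq_of_mem_supported (f := (E.bimodule.subtype.restrictScalars k) ∘ₗ
      (Finsupp.linearCombination (EnvelopingAlgebra k X) gen).restrictScalars k ∘ₗ L a b)
      (g := sg) (fun j hj => ?_) hw'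
    simp only [LinearMap.comp_apply, hL, LinearMap.restrictScalars_apply,
      Finsupp.linearCombination_single, map_smul]
    simp only [gen, dif_pos hj.1]
    change _ • BiMatrix.single _ _ _ = BiMatrix.single a b _
    rw [BiMatrix.unit_tmul_unit_smul hj.2.1 hj.2.2, BiMatrix.single_apply_same]
  apply Subtype.ext
  change (Finsupp.linearCombination (EnvelopingAlgebra k X) gen (∑ a, ∑ b, L a b (m.1 a b))).1 = m.1
  simp only [map_sum, Submodule.coe_sum, hπ _ _ _ (m.2 _ _)]
  rw [← BiMatrix.eq_sum_single m.1]

end Projective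

/-- Every bimodule map is given by a family of linear maps on the entries. These maps are only
determined on `E a b`, and are extended to `V` arbitrarily. -/
theorem exists_forall_hom_apply (f : E.bimodule →ₗ[EnvelopingAlgebra k X] E'.bimodule) :
    ∃ g : X → X → V →ₗ[k] W, ∀ a b (m : E.bimodule), g a b (m.1 a b) = (f m).1 a b := by
  have (a b : X) : ∃ g : V →ₗ[k] W, ∀ w (hw : w ∈ E.carrier a b),
      g w = (f (E.single a b ⟨w, hw⟩)).1 a b := by
    obtain ⟨g, hg⟩ := LinearMap.exists_extend (p := E.carrier a b)
      { toFun := fun w => (f (E.single a b w)).1 a b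
        map_add' := fun w w' => by rw [map_add, map_add]; rfl
        map_smul' := fun r w => by
          have : E.single a b (r • w) =
              (algebraMap k (EnvelopingAlgebra k X) r) • E.single a b w := by
            rw [map_smul, algebraMap_smul]
          rw [this, map_smul, algebraMap_smul]
          rfl }
    exact ⟨g, fun w hw => LinearMap.congr_fun hg ⟨w, hw⟩⟩
  choose g hg using this
  exact ⟨g, fun a b m => (hg a b _ (m.2 a b)).trans (hom_single_apply f m a b)⟩

theorem hom_compat {f : E.bimodule →ₗ[EnvelopingAlgebra k X] E'.bimodule}
    {g : X → X → V →ₗ[k] W} (hg : ∀ a b (m : E.bimodule), g a b (m.1 a b) = (f m).1 a b)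
    {a a' b b' : X} (ha : a' ≤ a) (hb : b ≤ b') {w : V} (hw : w ∈ E.carrier a b) :
    g a' b' w = g a b w := by
  have h₁ := hg a b (E.single a b ⟨w, hw⟩)
  have h₂ := hg a' b' (E.single a' b' ⟨w, E.mono ha hb hw⟩)
  simp only [coe_single, BiMatrix.single_apply_same] at h₁ h₂
  rw [h₁, h₂, hom_single_compat f ha hb w hw]

/-- The system with `E a b = F b` for `a ≤ b`, for an increasing family of subspaces `F`. It turns
representations of `X` into bimodules in an exact way. -/
noncomputable def ofMonotone (F : X → Submodule k V) (hF : Monotone F) : IntervalSystem k X V :=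
  open Classical in
  { carrier := fun a b => if a ≤ b then F b else ⊥
    mono := fun {a a' b b'} ha hb => by
      by_cases h : a ≤ b
      · rw [if_pos h, if_pos (ha.trans (h.trans hb))]
        exact hF hb
      · rw [if_neg h]
        exact bot_le
    eq_bot := fun h => if_neg h }

theorem ofMonotone_carrier (F : X → Submodule k V) (hF : Monotone F) {a b : X} (h : a ≤ b) :
    (ofMonotone F hF).carrier a b = F b := if_pos h

variable (k X) in
/-- The system of the regular bimodule: `k` at every nonempty interval. -/
noncomputable def regular : IntervalSystem k X k := ofMonotone (fun _ => ⊤) monotone_const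

theorem mem_regular {a b : X} {r : k} (h : ¬ a ≤ b → r = 0) : r ∈ (regular k X).carrier a b := by
  by_cases hab : a ≤ b
  · rw [regular, ofMonotone_carrier _ _ hab]
    trivial
  · simp [h hab]

/-- The map to the regular bimodule that applies a single functional to all entries. -/
noncomputable def functional (E : IntervalSystem k X V) (η : V →ₗ[k] k) :
    E.bimodule →ₗ[EnvelopingAlgebra k X] (regular k X).bimodule :=
  mapConst E (regular k X) η fun a b w hw => mem_regular fun h => by
    rw [E.eq_bot h, Submodule.mem_bot] at hw
    rw [hw, map_zero]

end IntervalSystem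

variable (k X) in
/-- The incidence algebra, as a bimodule over itself, consists of the matrices with entries in the
system `regular`. -/
noncomputable def regularBimoduleIso :
    ModuleCat.of (EnvelopingAlgebra k X) (IntervalSystem.regular k X).bimodule ≅
      regularBimodule.{u, max u v} k (IncidenceAlgebra k X) :=
  LinearEquiv.toModuleIso (X₁ := (IntervalSystem.regular k X).bimodule)
    (X₂ := regularBimodule.{u, max u v} k (IncidenceAlgebra k X)) <|
  LinearEquiv.symm <|
  let f : regularBimodule.{u, max u v} k (IncidenceAlgebra k X) →ₗ[EnvelopingAlgebra k X]
      (IntervalSystem.regular k X).bimodule :=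
    LinearMap.ofTmul
      { toFun := fun (x : IncidenceAlgebra k X) => ⟨fun a b => x a b, fun a b =>
          IntervalSystem.mem_regular fun h => x.apply_eq_zero_of_not_le h⟩
        map_zero' := rfl
        map_add' := fun _ _ => rfl }
      (by
        intro x y (m : IncidenceAlgebra k X)
        ext a b
        let m' : BiMatrix X k := fun a b => m a b
        change (x * (m * unop y)) a b = ((x ⊗ₜ[k] y) • m') a b
        simp only [BiMatrix.tmul_smul_apply, IncidenceAlgebra.mul_apply_eq_sum, Finset.mul_sum,
          smul_eq_mul]
        exact Finset.sum_congr rfl fun c _ => Finset.sum_congr rfl fun d _ => by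
          change _ = _ * m c d
          ring)
  LinearEquiv.ofBijective f
    ⟨fun x y h => IncidenceAlgebra.ext fun a b _ => congrFun₂ (congrArg Subtype.val h) a b,
      fun m => ⟨(⟨fun a b => m.1 a b, fun a b h => by
        have := m.2 a b
        rwa [IntervalSystem.eq_bot _ h, Submodule.mem_bot] at this⟩ : IncidenceAlgebra k X), rfl⟩⟩

end Bimodules

/-! ### The bar resolution of a bimodule with given end vertices -/

section BarResolution

open MulOpposite CategoryTheory

variable {k : Type u} [Field k] {X : Type v} [PartialOrder X] [LocallyFiniteOrder X]
  [DecidableEq X] [Fintype X]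

namespace IntervalSystem

/-- A sequence of bimodules given by linear maps of the ambient spaces is exact if it is so at every
position. -/
theorem shortExact_mapConst {V₁ V₂ V₃ : Type (max u v)} [AddCommGroup V₁] [Module k V₁]
    [AddCommGroup V₂] [Module k V₂] [AddCommGroup V₃] [Module k V₃]
    {E₁ : IntervalSystem k X V₁} {E₂ : IntervalSystem k X V₂} {E₃ : IntervalSystem k X V₃}
    {f : V₁ →ₗ[k] V₂} {g : V₂ →ₗ[k] V₃} (hf : ∀ a b, ∀ w ∈ E₁.carrier a b, f w ∈ E₂.carrier a b)
    (hg : ∀ a b, ∀ w ∈ E₂.carrier a b, g w ∈ E₃.carrier a b)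
    (hinj : ∀ a b, ∀ w ∈ E₁.carrier a b, f w = 0 → w = 0)
    (hzero : ∀ a b, ∀ w ∈ E₁.carrier a b, g (f w) = 0)
    (hexact : ∀ a b, ∀ w ∈ E₂.carrier a b, g w = 0 → ∃ u ∈ E₁.carrier a b, f u = w)
    (hsurj : ∀ a b, ∀ w ∈ E₃.carrier a b, ∃ u ∈ E₂.carrier a b, g u = w) :
    ∃ w : ModuleCat.ofHom (mapConst E₁ E₂ f hf) ≫ ModuleCat.ofHom (mapConst E₂ E₃ g hg) = 0,
      (ShortComplex.mk _ _ w).ShortExact := by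
  refine ⟨?_, ?_⟩
  · ext m a b
    exact hzero a b _ (m.2 a b)
  · refine ModuleCat.shortComplex_shortExact _ (fun m => ⟨fun hm => ?_, ?_⟩) ?_ fun m => ?_
    · choose u hu hu' using fun a b => hexact a b (m.1 a b) (m.2 a b)
        (congrFun₂ (congrArg Subtype.val hm) a b)
      exact ⟨⟨u, hu⟩, Subtype.ext (BiMatrix.ext hu')⟩
    · rintro ⟨n, rfl⟩
      exact Subtype.ext (BiMatrix.ext fun a b => hzero a b _ (n.2 a b))
    · refine (injective_iff_map_eq_zero (mapConst E₁ E₂ f hf)).2 fun m hm => ?_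
      exact Subtype.ext (BiMatrix.ext fun a b => hinj a b _ (m.2 a b)
        (congrFun₂ (congrArg Subtype.val hm) a b))
    · choose u hu hu' using fun a b => hsurj a b (m.1 a b) (m.2 a b)
      exact ⟨⟨u, hu⟩, Subtype.ext (BiMatrix.ext hu')⟩

end IntervalSystem

namespace ChainComplexOver

variable {C : Type (max u v)}

section Boundary

variable (k) in
/-- The linear extension of `(c, l) ↦ (c, x :: l)`. -/
noncomputable def prepend (x : X) : (C × List X →₀ k) →ₗ[k] (C × List X →₀ k) :=
  Finsupp.lmapDomain k k fun p => (p.1, x :: p.2)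

variable (k) in
/-- The boundary `∑ᵢ (-1)ⁱ (c, [x₀, …, x̂ᵢ, …, xₙ])` of the chain `(c, [x₀, …, xₙ])`, defined by
recursion on the list. -/
noncomputable def boundaryList (c : C) : List X → (C × List X →₀ k)
  | [] => 0
  | x :: l => Finsupp.single (c, l) 1 - prepend k x (boundaryList c l)

variable (k X C) in
/-- The simplicial boundary on formal combinations of pairs of a generator and a list. -/
noncomputable def boundary : (C × List X →₀ k) →ₗ[k] (C × List X →₀ k) :=
  Finsupp.linearCombination k fun p => boundaryList k p.1 p.2

theorem boundary_single (c : C) (l : List X) :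
    boundary k X C (Finsupp.single (c, l) 1) = boundaryList k c l := by
  simp [boundary]

theorem prepend_single (x : X) (c : C) (l : List X) :
    prepend k x (Finsupp.single (c, l) 1) = Finsupp.single (c, x :: l) 1 := by
  simp [prepend]

theorem boundary_prepend (x : X) (w : C × List X →₀ k) :
    boundary k X C (prepend k x w) = w - prepend k x (boundary k X C w) := by
  have : boundary k X C ∘ₗ prepend k x = LinearMap.id - prepend k x ∘ₗ boundary k X C := by
    refine Finsupp.lhom_ext' fun ⟨c, l⟩ => LinearMap.ext_ring ?_
    simp [prepend_single, boundary_single, boundaryList]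
  exact LinearMap.congr_fun this w

theorem boundary_boundary (w : C × List X →₀ k) : boundary k X C (boundary k X C w) = 0 := by
  have : boundary k X C ∘ₗ boundary k X C = 0 := by
    refine Finsupp.lhom_ext' fun p => LinearMap.ext_ring ?_
    obtain ⟨c, l⟩ := p
    simp only [LinearMap.comp_apply, Finsupp.lsingle_apply, boundary_single, LinearMap.zero_apply]
    induction l with
    | nil => simp [boundaryList]
    | cons x l ih =>
      rw [boundaryList, map_sub, boundary_prepend, boundary_single, ih]
      simp
  exact LinearMap.congr_fun this w

theorem boundaryList_mem_supported (c : C) (l : List X) :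
    boundaryList k c l ∈ Finsupp.supported k k
      {p : C × List X | p.1 = c ∧ p.2.Sublist l ∧ p.2.length + 1 = l.length} := by
  induction l with
  | nil => exact zero_mem _
  | cons x l ih =>
    refine sub_mem (Finsupp.single_mem_supported k _ ⟨rfl, List.sublist_cons_self x l, rfl⟩) ?_
    refine (Finsupp.supported_comap_lmapDomain k k _ _) ?_
    refine Finsupp.supported_mono ?_ ih
    rintro p ⟨h₁, h₂, h₃⟩
    exact ⟨h₁, h₂.cons_cons x, by simp [h₃]⟩

/-- The linear extension of `(c, l) ↦ (c, l ++ [b])`. -/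
noncomputable def append (b : X) : (C × List X →₀ k) →ₗ[k] (C × List X →₀ k) :=
  Finsupp.lmapDomain k k fun p => (p.1, p.2 ++ [b])

theorem append_single (x : X) (c : C) (l : List X) :
    append x (Finsupp.single (c, l) (1 : k)) = Finsupp.single (c, l ++ [x]) 1 := by
  simp [append]

theorem append_prepend (x b : X) (w : C × List X →₀ k) :
    append b (prepend k x w) = prepend k x (append b w) := by
  have : append b ∘ₗ prepend k x = prepend (C := C) k x ∘ₗ append b := by
    refine Finsupp.lhom_ext' fun ⟨c, l⟩ => LinearMap.ext_ring ?_
    simp [prepend_single, append_single]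
  exact LinearMap.congr_fun this w

theorem boundaryList_append (b : X) (c : C) (l : List X) :
    boundaryList k c (l ++ [b]) =
      append b (boundaryList k c l) + (-1 : k) ^ l.length • Finsupp.single (c, l) 1 := by
  induction l with
  | nil => simp [boundaryList]
  | cons x l ih =>
    simp only [List.cons_append, boundaryList, ih, map_add, map_sub, append_single, map_smul,
      append_prepend, prepend_single, List.length_cons, pow_succ]
    module

/-- Up to sign, `append b` is a contracting homotopy of the boundary. -/
theorem boundary_append (b : X) {n : ℕ} {w : C × List X →₀ k}
    (hw : w ∈ Finsupp.supported k k {p : C × List X | p.2.length = n}) :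
    boundary k X C (append b w) = append b (boundary k X C w) + (-1 : k) ^ n • w := by
  refine Finsupp.eq_of_mem_supported (f := boundary k X C ∘ₗ append b)
    (g := append b ∘ₗ boundary k X C + (-1 : k) ^ n • LinearMap.id) ?_ hw
  rintro ⟨c, l⟩ rfl
  simp [append_single, boundary_single, boundaryList_append]

end Boundary

variable (Y : Set C) (t : C → X)

/-- The chains `x₁ ≤ … ≤ xₙ` in `X`, repetitions allowed, over a generator `c ∈ Y`, that lie in the
interval `[a, b]` and above `t c`. The conditions `a ≤ b` and `t c ≤ b` matter for `n = 0` only. -/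
def chains (n : ℕ) (a b : X) : Set (C × List X) :=
  {p | p.1 ∈ Y ∧ a ≤ b ∧ t p.1 ≤ b ∧ p.2.Pairwise (· ≤ ·) ∧ p.2.length = n ∧
    ∀ x ∈ p.2, a ≤ x ∧ t p.1 ≤ x ∧ x ≤ b}

variable {Y t}

theorem chains_mono {n : ℕ} {a a' b b' : X} (ha : a' ≤ a) (hb : b ≤ b') :
    chains Y t n a b ⊆ chains Y t n a' b' := by
  rintro p ⟨h₁, h₂, h₃, h₄, h₅, h₆⟩
  exact ⟨h₁, ha.trans (h₂.trans hb), h₃.trans hb, h₄, h₅, fun x hx =>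
    ⟨ha.trans (h₆ x hx).1, (h₆ x hx).2.1, (h₆ x hx).2.2.trans hb⟩⟩

theorem boundary_mem {n : ℕ} {a b : X} {w : C × List X →₀ k}
    (hw : w ∈ Finsupp.supported k k (chains Y t (n + 1) a b)) :
    boundary k X C w ∈ Finsupp.supported k k (chains Y t n a b) := by
  refine Submodule.finsuppSum_mem _ _ _ _ fun p hp => Submodule.smul_mem _ _ ?_
  obtain ⟨h₁, h₂, h₃, h₄, h₅, h₆⟩ := hw (Finsupp.mem_support_iff.2 hp)
  refine Finsupp.supported_mono ?_ (boundaryList_mem_supported p.1 p.2)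
  rintro ⟨c, l⟩ ⟨rfl, h, hl⟩
  exact ⟨h₁, h₂, h₃, h₄.sublist h, by simp only [] at hl ⊢; omega, fun x hx => h₆ x (h.subset hx)⟩

theorem append_mem {n : ℕ} {a b : X} {w : C × List X →₀ k}
    (hw : w ∈ Finsupp.supported k k (chains Y t n a b)) :
    append b w ∈ Finsupp.supported k k (chains Y t (n + 1) a b) := by
  refine (Finsupp.supported_comap_lmapDomain k k _ _) (Finsupp.supported_mono ?_ hw)
  rintro p ⟨h₁, h₂, h₃, h₄, h₅, h₆⟩
  refine ⟨h₁, h₂, h₃, List.pairwise_append.2 ⟨h₄, List.pairwise_singleton _ _, ?_⟩,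
    by simp [h₅], ?_⟩
  · intro x hx y hy
    rw [List.mem_singleton.1 hy]
    exact (h₆ x hx).2.2
  · intro x hx
    rcases List.mem_append.1 hx with hx | hx
    · exact h₆ x hx
    · rw [List.mem_singleton.1 hx]
      exact ⟨h₂, h₃, le_rfl⟩

/-- The chain complex of an interval `[a, b]` is exact: appending the maximum `b` contracts it. -/
theorem exists_boundary_eq {n : ℕ} {a b : X} {w : C × List X →₀ k}
    (hw : w ∈ Finsupp.supported k k (chains Y t n a b)) (h : boundary k X C w = 0) :
    ∃ z ∈ Finsupp.supported k k (chains Y t (n + 1) a b), boundary k X C z = w := by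
  refine ⟨(-1 : k) ^ n • append b w, Submodule.smul_mem _ _ (append_mem hw), ?_⟩
  have := boundary_append b (n := n) (Finsupp.supported_mono (fun p hp => hp.2.2.2.2.1) hw)
  rw [map_smul, this, h, map_zero, zero_add]
  rw [smul_smul, ← mul_pow]
  simp

variable (k Y t) in
/-- The bimodule of `n`-chains. -/
noncomputable def chainSystem (n : ℕ) : IntervalSystem k X (C × List X →₀ k) where
  carrier a b := Finsupp.supported k k (chains Y t n a b)
  mono ha hb := Finsupp.supported_mono (chains_mono ha hb)
  eq_bot {a b} h := by
    have : chains Y t n a b = ∅ := Set.eq_empty_of_forall_notMem fun p hp => h hp.2.1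
    rw [this, Finsupp.supported_empty]

variable (k Y t) in
/-- The bimodule of `n`-chains with boundary zero. For `n = 0` these are all the `0`-chains, that
is, the span of the generators `c ∈ Y` with `t c ≤ b`. -/
noncomputable def cycleSystem (n : ℕ) : IntervalSystem k X (C × List X →₀ k) where
  carrier a b := Finsupp.supported k k (chains Y t n a b) ⊓ LinearMap.ker (boundary k X C)
  mono ha hb := inf_le_inf_right _ (Finsupp.supported_mono (chains_mono ha hb))
  eq_bot {a b} h := by
    rw [show Finsupp.supported k k (chains Y t n a b) = ⊥ from (chainSystem k Y t n).eq_bot h,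
      bot_inf_eq]

variable (t) in
/-- The first vertex of a chain; the default value for the empty chain plays no role. -/
def first (p : C × List X) : X := p.2.headD (t p.1)

variable (t) in
/-- The last vertex of a chain; the default value for the empty chain plays no role. -/
def last (p : C × List X) : X := p.2.getLastD (t p.1)

/-- A nonempty chain lies in `[a, b]` as soon as its two end vertices do. -/
theorem mem_chains_succ_iff {n : ℕ} {a b : X} {p : C × List X} :
    p ∈ chains Y t (n + 1) a b ↔
      (p ∈ chains Y t (n + 1) (first t p) (last t p)) ∧ a ≤ first t p ∧ last t p ≤ b := by
  constructor
  · rintro ⟨h₁, h₂, h₃, h₄, h₅, h₆⟩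
    obtain ⟨c, l⟩ := p
    obtain ⟨x, l, rfl⟩ := List.exists_of_length_succ l h₅
    have hf : first t (c, x :: l) = x := rfl
    have hne : x :: l ≠ [] := List.cons_ne_nil x l
    have hl : last t (c, x :: l) = (x :: l).getLast hne := by
      simp only [last, List.getLastD_cons, List.getLast_eq_getLastD]
    have hmem := List.getLast_mem hne
    have hxle : ∀ y ∈ x :: l, x ≤ y := fun y hy => by
      rcases List.mem_cons.1 hy with rfl | hy
      · exact le_rfl
      · exact List.rel_of_pairwise_cons h₄ hy
    have hlast : ∀ y ∈ x :: l, y ≤ (x :: l).getLast hne := fun y hy => by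
      rw [← List.dropLast_append_getLast hne] at hy h₄
      rcases List.mem_append.1 hy with hy | hy
      · exact (List.pairwise_append.1 h₄).2.2 y hy _ (by simp)
      · rw [List.mem_singleton.1 hy]
    rw [hf, hl]
    exact ⟨⟨h₁, hxle _ hmem, (h₆ _ hmem).2.1, h₄, h₅, fun y hy =>
      ⟨hxle y hy, (h₆ y hy).2.1, hlast y hy⟩⟩, (h₆ x (by simp)).1, (h₆ _ hmem).2.2⟩
  · rintro ⟨h, ha, hb⟩
    exact chains_mono ha hb h

instance projective_chainSystem (n : ℕ) :
    Projective (ModuleCat.of (EnvelopingAlgebra k X) (chainSystem k Y t (n + 1)).bimodule) := by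
  have := IntervalSystem.projective_of_carrier_eq_supported (chainSystem k Y t (n + 1))
    (fun p => p ∈ chains Y t (n + 1) (first t p) (last t p)) (first t) (last t)
    fun a b => congrArg (Finsupp.supported k k) (Set.ext fun p => mem_chains_succ_iff)
  infer_instance

variable (k Y t) in
/-- The bar resolution of the bimodule of `0`-chains, cut into short exact sequences. -/
theorem shortExact (n : ℕ) :
    ∃ w : ModuleCat.ofHom (IntervalSystem.mapConst (cycleSystem k Y t (n + 1))
          (chainSystem k Y t (n + 1)) LinearMap.id fun _ _ _ hw => hw.1) ≫
        ModuleCat.ofHom (IntervalSystem.mapConst (chainSystem k Y t (n + 1)) (cycleSystem k Y t n)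
          (boundary k X C) fun _ _ w hw => ⟨boundary_mem hw, boundary_boundary w⟩) = 0,
      (ShortComplex.mk _ _ w).ShortExact :=
  IntervalSystem.shortExact_mapConst _ _ (fun _ _ _ _ h => h) (fun _ _ _ hw => hw.2)
    (fun _ _ w hw h => ⟨w, ⟨hw, h⟩, rfl⟩) fun _ _ _ hw => exists_boundary_eq hw.1 hw.2

variable (k t) in
/-- The linear extension of `(c, l) ↦ (c, t c :: l)`, coning chains over `c` from the vertex `t c`
below which they cannot go. -/
noncomputable def cone : (C × List X →₀ k) →ₗ[k] (C × List X →₀ k) :=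
  Finsupp.lmapDomain k k fun p => (p.1, t p.1 :: p.2)

theorem boundary_cone (w : C × List X →₀ k) :
    boundary k X C (cone k t w) = w - cone k t (boundary k X C w) := by
  have : boundary k X C ∘ₗ cone k t = LinearMap.id - cone k t ∘ₗ boundary k X C := by
    refine Finsupp.lhom_ext' fun ⟨c, l⟩ => LinearMap.ext_ring ?_
    have h : prepend k (t c) (boundaryList k c l) = cone k t (boundaryList k c l) :=
      Finsupp.eq_of_mem_supported (by
        rintro ⟨_, l'⟩ ⟨rfl, -⟩
        simp [prepend, cone]) (boundaryList_mem_supported c l)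
    simp only [LinearMap.comp_apply, Finsupp.lsingle_apply, LinearMap.sub_apply, LinearMap.id_apply,
      boundary_single, ← h]
    rw [cone, Finsupp.lmapDomain_apply, Finsupp.mapDomain_single, boundary_single, boundaryList]
  exact LinearMap.congr_fun this w

/-- A bimodule map from the cycles to the regular bimodule is given by a single functional, so it
extends to the chains. It corresponds to a cocycle `Θ` on the chains. All nonzero entries of the
regular bimodule are the same field `k`, so the value of `Θ` on a chain over `c` is the same at
`(t c, b)` as at `(a, b)`. At `(t c, b)` the cone with apex `t c` is available, even if `t c` is not
in `[a, b]`, and makes `Θ` a coboundary. -/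
theorem exists_extension (i : ℕ)
    (f : (cycleSystem k Y t (i + 1)).bimodule →ₗ[EnvelopingAlgebra k X]
      (IntervalSystem.regular k X).bimodule) :
    ∃ η : (C × List X →₀ k) →ₗ[k] k, ∀ m a b, η (m.1 a b) = (f m).1 a b := by
  obtain ⟨g, hg⟩ := IntervalSystem.exists_forall_hom_apply f
  let Θ : (C × List X →₀ k) →ₗ[k] k := Finsupp.linearCombination k fun p =>
    g (first t p) (last t p) (boundary k X C (Finsupp.single p 1))
  have hΘ : ∀ a b, ∀ w ∈ Finsupp.supported k k (chains Y t (i + 2) a b),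
      Θ w = g a b (boundary k X C w) := by
    intro a b w hw
    refine Finsupp.eq_of_mem_supported (g := g a b ∘ₗ boundary k X C) (fun p hp => ?_) hw
    obtain ⟨h, ha, hb⟩ := mem_chains_succ_iff.1 hp
    have := IntervalSystem.hom_compat hg ha hb (w := boundary k X C (Finsupp.single p 1))
      ⟨boundary_mem (Finsupp.single_mem_supported k _ h), boundary_boundary _⟩
    simp [Θ, this]
  -- `Θ` vanishes on boundaries, hence `Θ w = Θ (cone (∂ w))`
  refine ⟨Θ ∘ₗ cone k t, fun m a b => ?_⟩
  rw [← hg]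
  obtain ⟨z, hz, hzm⟩ := exists_boundary_eq (m.2 a b).1 (m.2 a b).2
  rw [← hzm, ← hΘ a b z hz, LinearMap.comp_apply]
  have h₀ : Θ (boundary k X C (cone k t z)) = 0 := by
    refine Finsupp.eq_of_mem_supported (f := Θ ∘ₗ boundary k X C ∘ₗ cone k t) (g := 0)
      (fun p hp => ?_) hz
    obtain ⟨h₁, h₂, h₃, h₄, h₅, h₆⟩ := hp
    have hc : cone k t (Finsupp.single p 1) ∈
        Finsupp.supported k k (chains Y t (i + 3) (t p.1) b) := by
      rw [cone, Finsupp.lmapDomain_apply, Finsupp.mapDomain_single]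
      refine Finsupp.single_mem_supported k _ ⟨h₁, h₃, h₃,
        List.pairwise_cons.2 ⟨fun x hx => (h₆ x hx).2.1, h₄⟩, by simp [h₅], fun x hx => ?_⟩
      rcases List.mem_cons.1 hx with rfl | hx
      · exact ⟨le_rfl, le_rfl, h₃⟩
      · exact ⟨(h₆ x hx).2.1, (h₆ x hx).2.1, (h₆ x hx).2.2⟩
    simp only [LinearMap.comp_apply]
    rw [hΘ _ _ _ (boundary_mem hc), boundary_boundary, map_zero, LinearMap.zero_apply]
  rw [boundary_cone, map_sub, sub_eq_zero] at h₀
  exact h₀.symm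

/-- The bimodule of `0`-chains is acyclic for `Ext(-, Λ)`. -/
theorem subsingleton_ext (i : ℕ) : Subsingleton (Abelian.Ext.{max u v}
    (ModuleCat.of (EnvelopingAlgebra k X) (cycleSystem k Y t 0).bimodule)
    (ModuleCat.of (EnvelopingAlgebra k X) (IntervalSystem.regular k X).bimodule) (i + 1)) := by
  let : CategoryTheory.Linear k (ModuleCat.{max u v} (EnvelopingAlgebra k X)) :=
    ModuleCat.Algebra.instLinear
  choose w hw using shortExact k Y t
  obtain ⟨δ, hδ, hδ'⟩ := exists_linearMap_ext_of_acyclic (R := k)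
    (N := ModuleCat.of (EnvelopingAlgebra k X) (IntervalSystem.regular k X).bimodule) i
    (fun n => ModuleCat.of (EnvelopingAlgebra k X) (cycleSystem k Y t n).bimodule)
    (fun n => ModuleCat.of (EnvelopingAlgebra k X) (chainSystem k Y t (n + 1)).bimodule) _ _ w hw
    (fun n j => Abelian.Ext.subsingleton_of_projective _ _ _)
  refine subsingleton_of_forall_eq 0 fun x => ?_
  obtain ⟨φ, rfl⟩ := hδ x
  rw [hδ']
  obtain ⟨η, hη⟩ := exists_extension i φ.hom
  refine ⟨ModuleCat.ofHom ((chainSystem k Y t (i + 1)).functional η), ?_⟩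
  ext m a b
  exact hη m a b

end ChainComplexOver

end BarResolution

/-! ### Exactness of the complex of cycles -/

namespace CycleStage

variable {k : Type u} [Field k] {P : Type v} [PartialOrder P]

theorem kerAt_mono (S : CycleStage k P) : Monotone S.kerAt := fun _ _ h =>
  inf_le_inf_left _ (Finsupp.supported_mono fun _ hc => lt_of_lt_of_le hc h)

theorem kerAt_bot [OrderBot P] (S : CycleStage k P) : S.kerAt ⊥ = ⊥ := by
  have : {c | S.top c < ⊥} = ∅ := Set.eq_empty_of_forall_notMem fun c hc => not_lt_bot hc
  rw [kerAt, this, Finsupp.supported_empty, inf_bot_eq]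

theorem kerAt_le_kerPred [Finite P] (S : CycleStage k P) {y z : P} (h : y < z) :
    S.kerAt y ≤ S.kerPred z := by
  obtain ⟨z', hy, hz⟩ := exists_le_covBy_of_lt h
  exact (S.kerAt_mono hy).trans (le_iSup₂_of_le z' hz le_rfl)

section Next

variable (S : CycleStage k P) (B : P → Set (S.C →₀ k))

/-- The map `(S.next B).bd`, with its target stated as the space on `S.C`, to which
`(S.next B).D` unfolds. -/
noncomputable def nextBd : ((S.next B).C →₀ k) →ₗ[k] (S.C →₀ k) := (S.next B).bd

variable {S B}

theorem nextBd_single (c : (S.next B).C) : nextBd S B (Finsupp.single c 1) = c.1.1 := by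
  refine (Finsupp.linearCombination_single k 1 c).trans (one_smul k _)

theorem mem_of_top_eq {c : (S.next B).C} {z : P} (h : (S.next B).top c = z) : c.1.1 ∈ B z := by
  subst h
  exact c.2

variable (hB : ∀ z, S.IsComplementBasis z (B z))

include hB

theorem mem_kerAt_top (c : (S.next B).C) : c.1.1 ∈ S.kerAt ((S.next B).top c) := by
  rw [← (hB _).sup_eq]
  exact Submodule.mem_sup_right (Submodule.subset_span c.2)

theorem top_ne_bot [OrderBot P] (c : (S.next B).C) : (S.next B).top c ≠ ⊥ := by
  intro h
  have h₁ := mem_kerAt_top hB c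
  rw [h, kerAt_bot, Submodule.mem_bot] at h₁
  exact (hB _).linearIndependent.ne_zero (⟨c.1.1, c.2⟩ : B c.1.2) h₁

theorem nextBd_mem_kerAt {z : P} {w : (S.next B).C →₀ k}
    (hw : w ∈ Finsupp.supported k k {c | (S.next B).top c ≤ z}) : nextBd S B w ∈ S.kerAt z := by
  refine Submodule.finsuppSum_mem _ _ _ _ fun c hc => Submodule.smul_mem _ _ ?_
  exact S.kerAt_mono (hw (Finsupp.mem_support_iff.2 hc)) (mem_kerAt_top hB c)

theorem nextBd_mem_kerPred [Finite P] {z : P} {w : (S.next B).C →₀ k}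
    (hw : w ∈ Finsupp.supported k k {c | (S.next B).top c < z}) :
    nextBd S B w ∈ S.kerPred z := by
  refine Submodule.finsuppSum_mem _ _ _ _ fun c hc => Submodule.smul_mem _ _ ?_
  exact S.kerAt_le_kerPred (hw (Finsupp.mem_support_iff.2 hc)) (mem_kerAt_top hB c)

/-- The new cycles ending at vertices `≤ z` generate `(ker ∂)_z`, by induction on `z`. -/
theorem exists_nextBd_eq [Finite P] (z : P) : ∀ w ∈ S.kerAt z,
    ∃ u ∈ Finsupp.supported k k {c | (S.next B).top c ≤ z}, nextBd S B u = w := by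
  suffices h : S.kerAt z ≤
      (Finsupp.supported k k {c | (S.next B).top c ≤ z}).map (nextBd S B) from fun w hw => h hw
  induction z using WellFoundedLT.induction with
  | ind z ih =>
    rw [← (hB z).sup_eq]
    refine sup_le (iSup₂_le fun z' hz' => (ih z' hz'.lt).trans (Submodule.map_mono
      (Finsupp.supported_mono fun c hc => le_trans hc hz'.lt.le))) ?_
    refine Submodule.span_le.2 fun w hw => ?_
    exact ⟨Finsupp.single (⟨(w, z), hw⟩ : (S.next B).C) 1,
      Finsupp.single_mem_supported k _ (le_refl z), nextBd_single _⟩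

theorem linearIndepOn_top (z : P) :
    LinearIndepOn k (fun c : (S.next B).C => c.1.1) {c | (S.next B).top c = z} := by
  refine (hB z).linearIndependent.comp
    (fun c : {c | (S.next B).top c = z} => (⟨c.1.1.1, mem_of_top_eq c.2⟩ : B z)) fun c c' h => ?_
  exact Subtype.ext (Subtype.ext (Prod.ext (congrArg Subtype.val h) (c.2.trans c'.2.symm)))

/-- In a combination of new cycles ending at vertices `≤ z` whose boundary vanishes, no cycle ends
at `z` itself: those cycles are a basis of a complement of the span of the other boundaries. -/
theorem lt_of_nextBd_eq_zero [Finite P] {z : P} {w : (S.next B).C →₀ k}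
    (hw : w ∈ Finsupp.supported k k {c | (S.next B).top c ≤ z}) (h : nextBd S B w = 0) :
    w ∈ Finsupp.supported k k {c | (S.next B).top c < z} := by
  classical
  set w₁ := w.filter fun c => (S.next B).top c = z
  set w₂ := w.filter fun c => ¬ (S.next B).top c = z
  have hadd : w₁ + w₂ = w := Finsupp.filter_add_filter_not w _
  have hw₁ : w₁ ∈ Finsupp.supported k k {c | (S.next B).top c = z} := fun c hc => by
    have := (Finset.mem_coe.1 hc)
    rw [Finsupp.support_filter, Finset.mem_filter] at this
    exact this.2
  have hw₂ : w₂ ∈ Finsupp.supported k k {c | (S.next B).top c < z} := fun c hc => by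
    have := (Finset.mem_coe.1 hc)
    rw [Finsupp.support_filter, Finset.mem_filter] at this
    exact lt_of_le_of_ne (hw this.1) this.2
  have h₁ : nextBd S B w₁ ∈ Submodule.span k (B z) := by
    refine Submodule.finsuppSum_mem _ _ _ _ fun c hc => Submodule.smul_mem _ _ ?_
    have hc' : c.1.2 = z := hw₁ (Finsupp.mem_support_iff.2 hc)
    refine Submodule.subset_span ?_
    rw [← hc']
    exact c.2
  have h₂ := nextBd_mem_kerPred hB hw₂
  have h₃ : nextBd S B w₁ = - nextBd S B w₂ := by
    rw [eq_neg_iff_add_eq_zero, ← map_add, hadd, h]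
  have h₄ : nextBd S B w₁ = 0 :=
    Submodule.disjoint_def.1 (hB z).disjoint _ (h₃ ▸ neg_mem h₂) h₁
  have h₅ : w₁ = 0 := linearIndepOn_iff.1 (linearIndepOn_top hB z) w₁ hw₁ h₄
  rw [← hadd, h₅, zero_add]
  exact hw₂

theorem finite_next [Finite P] [Finite S.C] : Finite (S.next B).C := by
  have (z : P) : Finite (B z) := (hB z).linearIndependent.finite
  refine Finite.of_injective (β := Σ z, B z) (fun c => ⟨c.1.2, c.1.1, c.2⟩) ?_
  rintro ⟨⟨w, z⟩, h⟩ ⟨⟨w', z'⟩, h'⟩ heq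
  simp only [Sigma.mk.injEq] at heq
  obtain ⟨rfl, heq⟩ := heq
  exact Subtype.ext (Prod.ext (by simpa using heq) rfl)

omit hB in
theorem ncard_top_eq (z : P) : {c | (S.next B).top c = z}.ncard = (B z).ncard := by
  refine Set.ncard_congr (fun c _ => c.1.1) ?_ ?_ ?_
  · rintro ⟨⟨w, z'⟩, h⟩ (rfl : z' = z)
    exact h
  · rintro ⟨⟨w, z₁⟩, h⟩ ⟨⟨w', z₂⟩, h'⟩ (rfl : z₁ = z) (rfl : z₂ = z₁) (rfl : w = w')
    rfl
  · exact fun w hw => ⟨⟨(w, z), hw⟩, rfl, rfl⟩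

end Next

instance (x : P) : Subsingleton (initial k x).C :=
  inferInstanceAs (Subsingleton (ULift ({x} : Set P)))

/-- The step from `C⁰` to `C¹` follows the same rule as the later ones: `x*` itself is a basis of a
complement when `z` covers `x*`, and the complement is zero otherwise. -/
theorem initial_isComplementBasis [OrderBot P] [Finite P] (z : P) :
    (initial k (⊥ : P)).IsComplementBasis z
      {w | ⊥ ⋖ z ∧ w = Finsupp.single ⟨⊥, rfl⟩ 1} := by
  have hker {y : P} (hy : ⊥ < y) : (initial k (⊥ : P)).kerAt y = ⊤ := by
    refine eq_top_iff.2 fun w _ => ⟨rfl, fun c _ => ?_⟩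
    have : (initial k (⊥ : P)).top c = ⊥ := c.down.2
    rwa [Set.mem_ofPred_eq, this]
  by_cases hz : ⊥ ⋖ z
  · have hpred : (initial k (⊥ : P)).kerPred z = ⊥ := by
      refine eq_bot_iff.2 (iSup₂_le fun y hy => ?_)
      have : y = ⊥ := by
        by_contra h
        exact hz.2 (bot_lt_iff_ne_bot.2 h) hy.lt
      rw [this, kerAt_bot]
    have hB : {w : (initial k (⊥ : P)).C →₀ k | ⊥ ⋖ z ∧ w = Finsupp.single ⟨⊥, rfl⟩ 1} =
        {Finsupp.single ⟨⊥, rfl⟩ 1} := by simp [hz]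
    rw [hB]
    refine ⟨?_, by simp [hpred], ?_⟩
    · exact (linearIndepOn_singleton_iff k (v := id)).2 (Finsupp.single_ne_zero.2 one_ne_zero)
    · rw [hpred, hker hz.lt, bot_sup_eq, eq_top_iff]
      intro w _
      obtain ⟨c₀, hc₀⟩ : ∃ c₀ : (initial k (⊥ : P)).C, c₀ = ⟨⊥, rfl⟩ := ⟨_, rfl⟩
      rw [← hc₀]
      have : w = w c₀ • Finsupp.single c₀ 1 := by
        ext c
        rw [Subsingleton.elim c c₀]
        simp
      rw [this]
      exact Submodule.smul_mem _ _ (Submodule.mem_span_singleton_self _)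
  · have hB : {w : (initial k (⊥ : P)).C →₀ k | ⊥ ⋖ z ∧ w = Finsupp.single ⟨⊥, rfl⟩ 1} = ∅ := by
      simp [hz]
    rw [hB]
    refine ⟨linearIndependent_empty k _, by simp, ?_⟩
    rw [Submodule.span_empty, sup_bot_eq]
    refine le_antisymm (kerPred_le _ _) ?_
    rcases eq_or_ne z ⊥ with rfl | hne
    · simp [kerAt_bot]
    · obtain ⟨y, hy, hyz⟩ := (not_covBy_iff (bot_lt_iff_ne_bot.2 hne)).1 hz
      refine le_trans ?_ (kerAt_le_kerPred _ hyz)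
      rw [hker hy]
      exact le_top

end CycleStage

namespace BasisChoice

variable {k : Type u} [Field k] {P : Type v} [PartialOrder P] [OrderBot P] [Finite P]
  (β : BasisChoice k P)

/-- The map `∂ₙ₊₁ : kCⁿ⁺¹ → kCⁿ`. It is defined by cases because the target of
`(β.stage ⊥ (n + 1)).bd` unfolds to the space on `(β.stage ⊥ n).C` only for concrete `n`. -/
noncomputable def boundary :
    ∀ n, ((β.stage ⊥ (n + 1)).C →₀ k) →ₗ[k] ((β.stage ⊥ n).C →₀ k)
  | 0 => (β.stage ⊥ 1).bd
  | n + 1 => (β.stage ⊥ (n + 2)).bd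

theorem mem_kerAt_succ {n : ℕ} {z : P} {w : (β.stage ⊥ (n + 1)).C →₀ k} :
    w ∈ (β.stage ⊥ (n + 1)).kerAt z ↔
      β.boundary n w = 0 ∧ w ∈ Finsupp.supported k k {c | (β.stage ⊥ (n + 1)).top c < z} := by
  cases n <;> exact Iff.rfl

theorem top_ne_bot (n : ℕ) (c : (β.stage ⊥ (n + 1)).C) : (β.stage ⊥ (n + 1)).top c ≠ ⊥ := by
  cases n with
  | zero => exact CycleStage.top_ne_bot CycleStage.initial_isComplementBasis c
  | succ n => exact CycleStage.top_ne_bot (β.isComplementBasis (n + 1) _) c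

theorem boundary_mem_kerAt {n : ℕ} {z : P} {w : (β.stage ⊥ (n + 1)).C →₀ k}
    (hw : w ∈ Finsupp.supported k k {c | (β.stage ⊥ (n + 1)).top c ≤ z}) :
    β.boundary n w ∈ (β.stage ⊥ n).kerAt z := by
  cases n with
  | zero => exact CycleStage.nextBd_mem_kerAt CycleStage.initial_isComplementBasis hw
  | succ n => exact CycleStage.nextBd_mem_kerAt (β.isComplementBasis (n + 1) _) hw

theorem exists_boundary_eq {n : ℕ} {z : P} {w : (β.stage ⊥ n).C →₀ k}
    (hw : w ∈ (β.stage ⊥ n).kerAt z) :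
    ∃ u ∈ Finsupp.supported k k {c | (β.stage ⊥ (n + 1)).top c ≤ z}, β.boundary n u = w := by
  cases n with
  | zero => exact CycleStage.exists_nextBd_eq CycleStage.initial_isComplementBasis z w hw
  | succ n => exact CycleStage.exists_nextBd_eq (β.isComplementBasis (n + 1) _) z w hw

theorem mem_kerAt_of_boundary_eq_zero {n : ℕ} {z : P} {w : (β.stage ⊥ (n + 1)).C →₀ k}
    (hw : w ∈ Finsupp.supported k k {c | (β.stage ⊥ (n + 1)).top c ≤ z})
    (h : β.boundary n w = 0) : w ∈ (β.stage ⊥ (n + 1)).kerAt z := by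
  rw [mem_kerAt_succ]
  refine ⟨h, ?_⟩
  cases n with
  | zero => exact CycleStage.lt_of_nextBd_eq_zero CycleStage.initial_isComplementBasis hw h
  | succ n => exact CycleStage.lt_of_nextBd_eq_zero (β.isComplementBasis (n + 1) _) hw h

theorem finite_stage (n : ℕ) : Finite (β.stage ⊥ n).C := by
  induction n with
  | zero => exact inferInstanceAs (Finite (ULift ({⊥} : Set P)))
  | succ n ih =>
    cases n with
    | zero =>
      have : Finite (CycleStage.initial k (⊥ : P)).C := ih
      exact CycleStage.finite_next CycleStage.initial_isComplementBasis
    | succ n => exact CycleStage.finite_next (β.isComplementBasis (n + 1) _)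

theorem finite_cyclesAt (n : ℕ) (z : P) : (β.cyclesAt ⊥ n z).Finite :=
  have := β.finite_stage n
  Set.toFinite _

/-- The basis of a complement chosen for the vertex `z` in degree `n + 2`, whose elements `w` give
the cycles `(w, z)` of `Bⁿ⁺²_z`. -/
abbrev basisAt (n : ℕ) (z : P) : Set ((β.stage ⊥ (n + 1)).C →₀ k) :=
  β.basis (n + 1) (β.stage ⊥ (n + 1)) z

theorem finrank_span_basisAt (n : ℕ) (z : P) :
    Module.finrank k (Submodule.span k (β.basisAt n z)) = (β.cyclesAt ⊥ (n + 2) z).ncard := by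
  have h := (β.isComplementBasis (n + 1) (β.stage ⊥ (n + 1)) z).linearIndependent
  have := β.finite_stage (n + 1)
  have := h.finite
  have := Fintype.ofFinite (β.basisAt n z)
  rw [finrank_span_set_eq_card h, ← Set.ncard_eq_toFinset_card']
  exact (CycleStage.ncard_top_eq z).symm

end BasisChoice

/-! ### The resolution of the regular bimodule by cycles -/

section CyclesToCohomology

open MulOpposite CategoryTheory

variable {k : Type u} [Field k] {X : Type v} [PartialOrder X] [LocallyFiniteOrder X]
  [DecidableEq X] [Fintype X]

namespace IntervalSystem

variable {V W : Type*} [AddCommGroup V] [Module k V] [AddCommGroup W] [Module k W]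
  {F : X → Submodule k V} {hF : Monotone F} {E' : IntervalSystem k X W}
  {f : (ofMonotone F hF).bimodule →ₗ[EnvelopingAlgebra k X] E'.bimodule}
  {g : X → X → V →ₗ[k] W}

theorem mem_ofMonotone {a b : X} {w : V} (h : w ∈ (ofMonotone F hF).carrier a b) : w ∈ F b := by
  by_cases hab : a ≤ b
  · rwa [ofMonotone_carrier F hF hab] at h
  · rw [eq_bot _ hab, Submodule.mem_bot] at h
    rw [h]
    exact zero_mem _

/-- A map out of a one-sided system acts on a vector `w ∈ F b` in the same way at all positions `(a,
b')` with `b ≤ b'`, since `(a, b')` is connected to `(b, b)` through `(b', b')` and `(b, b')`. -/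
theorem hom_diag_eq
    (hg : ∀ a b (m : (ofMonotone F hF).bimodule), g a b (m.1 a b) = (f m).1 a b) {a b b' : X}
    (ha : a ≤ b') (hb : b ≤ b') {w : V} (hw : w ∈ F b) : g a b' w = g b b w := by
  have h₁ := hom_compat hg (le_refl b) hb (w := w) (by rwa [ofMonotone_carrier _ _ le_rfl])
  have h₂ := hom_compat hg hb (le_refl b') (w := w)
    (by rw [ofMonotone_carrier _ _ le_rfl]; exact hF hb hw)
  have h₃ := hom_compat hg ha (le_refl b') (w := w)
    (by rw [ofMonotone_carrier _ _ le_rfl]; exact hF hb hw)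
  rw [h₃, ← h₂, h₁]

end IntervalSystem

namespace BasisChoice

variable [Nonempty X] (β : BasisChoice k (StarPoset X))

open IntervalSystem ChainComplexOver

/-- The embedding of `X` in `X* = X ∪ {x*, y*}`. -/
def inner (x : X) : StarPoset X := ((x : WithTop X) : WithBot (WithTop X))

theorem inner_le_inner {x y : X} : inner x ≤ inner y ↔ x ≤ y := by
  simp [inner]

theorem inner_lt_top (x : X) : inner x < ⊤ := by
  rw [inner, ← WithBot.coe_top, WithBot.coe_lt_coe]
  exact WithTop.coe_lt_top x

theorem bot_lt_inner (x : X) : ⊥ < inner x := WithBot.bot_lt_coe _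

theorem exists_eq_inner {z : StarPoset X} (h₁ : z ≠ ⊥) (h₂ : z < ⊤) : ∃ x, z = inner x := by
  obtain _ | _ | x := z
  · exact absurd rfl h₁
  · exact absurd h₂ (lt_irrefl _)
  · exact ⟨x, rfl⟩

/-- The cycles of degree `n + 1` that end in `X`. -/
def innerCycles (n : ℕ) : Set (β.stage ⊥ (n + 1)).C := {c | (β.stage ⊥ (n + 1)).top c < ⊤}

/-- The end vertex of a cycle, as an element of `X`. For cycles that end at `y*` the value is
arbitrary. -/
noncomputable def endVertex (n : ℕ) (c : (β.stage ⊥ (n + 1)).C) : X :=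
  open Classical in
  if h : ∃ x, (β.stage ⊥ (n + 1)).top c = inner x then h.choose else Classical.arbitrary X

theorem inner_endVertex {n : ℕ} {c : (β.stage ⊥ (n + 1)).C} (hc : c ∈ β.innerCycles n) :
    (β.stage ⊥ (n + 1)).top c = inner (β.endVertex n c) := by
  have h := exists_eq_inner (β.top_ne_bot n c) hc
  rw [endVertex, dif_pos h]
  exact h.choose_spec

theorem top_le_inner_iff {n : ℕ} {c : (β.stage ⊥ (n + 1)).C} {b : X} :
    (β.stage ⊥ (n + 1)).top c ≤ inner b ↔ c ∈ β.innerCycles n ∧ β.endVertex n c ≤ b := by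
  constructor
  · intro h
    have hc : c ∈ β.innerCycles n := h.trans_lt (inner_lt_top b)
    rw [β.inner_endVertex hc, inner_le_inner] at h
    exact ⟨hc, h⟩
  · rintro ⟨hc, h⟩
    rwa [β.inner_endVertex hc, inner_le_inner]

theorem kerAt_inner_mono (n : ℕ) : Monotone fun b : X => (β.stage ⊥ n).kerAt (inner b) :=
  fun _ _ h => (β.stage ⊥ n).kerAt_mono (inner_le_inner.2 h)

theorem mem_supported_le {n : ℕ} {z : StarPoset X} {w : (β.stage ⊥ n).C →₀ k}
    (hw : w ∈ Finsupp.supported k k {c | (β.stage ⊥ n).top c < z}) :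
    w ∈ Finsupp.supported k k {c | (β.stage ⊥ n).top c ≤ z} :=
  Finsupp.supported_mono (fun _ (hc : _ < z) => hc.le) hw

/-- The bimodule of cycle spaces, with `(ker ∂ₙ)_b` at `(a, b)` for `a ≤ b` in `X`. -/
noncomputable def kerSystem (n : ℕ) : IntervalSystem k X ((β.stage ⊥ n).C →₀ k) :=
  ofMonotone (fun b => (β.stage ⊥ n).kerAt (inner b)) (β.kerAt_inner_mono n)

theorem mem_kerSystem {n : ℕ} {a b : X} {w : (β.stage ⊥ n).C →₀ k}
    (hw : w ∈ (β.stage ⊥ n).kerAt (inner b)) (hab : a ≤ b) :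
    w ∈ (β.kerSystem n).carrier a b := by
  rwa [kerSystem, ofMonotone_carrier _ _ hab]

theorem mem_kerAt_inner {n : ℕ} {a b : X} {w : (β.stage ⊥ n).C →₀ k}
    (hw : w ∈ (β.kerSystem n).carrier a b) : w ∈ (β.stage ⊥ n).kerAt (inner b) :=
  mem_ofMonotone (F := fun b => (β.stage ⊥ n).kerAt (inner b)) hw

/-- The bimodule generated by the inner `(n + 1)`-cycles: at `(a, b)`, for `a ≤ b`, it is spanned by
the cycles ending at vertices `≤ b`. It is written as the bimodule of `0`-chains over these cycles,
so that a vector carries an empty list. -/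
noncomputable abbrev cycleModule (n : ℕ) :
    IntervalSystem k X ((β.stage ⊥ (n + 1)).C × List X →₀ k) :=
  cycleSystem k (β.innerCycles n) (β.endVertex n) 0

/-- The linear extension of `c ↦ (c, [])`. -/
noncomputable def withNil (n : ℕ) :
    ((β.stage ⊥ n).C →₀ k) →ₗ[k] ((β.stage ⊥ n).C × List X →₀ k) :=
  Finsupp.lmapDomain k k fun c => (c, [])

/-- The linear extension of the projection `(c, l) ↦ c`. -/
noncomputable def forgetChain (n : ℕ) :
    ((β.stage ⊥ n).C × List X →₀ k) →ₗ[k] ((β.stage ⊥ n).C →₀ k) :=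
  Finsupp.lmapDomain k k Prod.fst

theorem forgetChain_withNil (n : ℕ) (w : (β.stage ⊥ n).C →₀ k) :
    β.forgetChain n (β.withNil (X := X) n w) = w := by
  simp only [forgetChain, withNil, Finsupp.lmapDomain_apply, ← Finsupp.mapDomain_comp]
  exact Finsupp.mapDomain_id

theorem withNil_single (n : ℕ) (c : (β.stage ⊥ n).C) :
    β.withNil (X := X) n (Finsupp.single c 1) = Finsupp.single (c, []) 1 := by
  simp [withNil]

theorem withNil_mem {n : ℕ} {a b : X} (hab : a ≤ b) {w : (β.stage ⊥ (n + 1)).C →₀ k}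
    (hw : w ∈ Finsupp.supported k k {c | (β.stage ⊥ (n + 1)).top c ≤ inner b}) :
    β.withNil (n + 1) w ∈ (β.cycleModule n).carrier a b := by
  constructor
  · refine (Finsupp.supported_comap_lmapDomain k k _ _) (Finsupp.supported_mono ?_ hw)
    intro c hc
    obtain ⟨h₁, h₂⟩ := β.top_le_inner_iff.1 hc
    exact ⟨h₁, hab, h₂, List.Pairwise.nil, rfl, by simp⟩
  · have : ChainComplexOver.boundary k X _ ∘ₗ β.withNil (X := X) (n + 1) = 0 := by
      refine Finsupp.lhom_ext' fun c => LinearMap.ext_ring ?_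
      simp [withNil_single, boundary_single, boundaryList]
    exact LinearMap.congr_fun this w

theorem forgetChain_mem {n : ℕ} {a b : X} {w : (β.stage ⊥ (n + 1)).C × List X →₀ k}
    (hw : w ∈ (β.cycleModule n).carrier a b) :
    β.forgetChain (n + 1) w ∈
      Finsupp.supported k k {c | (β.stage ⊥ (n + 1)).top c ≤ inner b} := by
  refine Submodule.finsuppSum_mem _ _ _ _ fun p hp => ?_
  obtain ⟨h₁, -, h₃, -⟩ := hw.1 (Finsupp.mem_support_iff.2 hp)
  exact Finsupp.single_mem_supported k _ (β.top_le_inner_iff.2 ⟨h₁, h₃⟩)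

theorem withNil_forgetChain {n : ℕ} {a b : X} {w : (β.stage ⊥ (n + 1)).C × List X →₀ k}
    (hw : w ∈ (β.cycleModule n).carrier a b) :
    β.withNil (n + 1) (β.forgetChain (n + 1) w) = w := by
  refine Finsupp.eq_of_mem_supported (f := β.withNil (n + 1) ∘ₗ β.forgetChain (n + 1))
    (g := LinearMap.id) ?_ hw.1
  rintro ⟨c, l⟩ ⟨-, -, -, -, hl, -⟩
  obtain rfl := List.length_eq_zero_iff.1 hl
  simp [forgetChain, withNil_single]

/-- The complex of cycles, restricted to `X`, is exact: the bimodule of inner `(n + 1)`-cycles maps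
onto the bimodule of the `(ker ∂ₙ)_b`, and the kernel consists of the `(ker ∂ₙ₊₁)_b`. -/
theorem shortExact (n : ℕ) :
    ∃ w : ModuleCat.ofHom (mapConst (β.kerSystem (n + 1)) (β.cycleModule n) (β.withNil (n + 1))
          fun a b w hw => by
            by_cases hab : a ≤ b
            · exact β.withNil_mem hab
                (β.mem_supported_le (β.mem_kerAt_succ.1 (β.mem_kerAt_inner hw)).2)
            · rw [eq_bot _ hab, Submodule.mem_bot] at hw
              rw [hw, map_zero]
              exact zero_mem _) ≫
        ModuleCat.ofHom (mapConst (β.cycleModule n) (β.kerSystem n)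
          (β.boundary n ∘ₗ β.forgetChain (n + 1)) fun a b w hw => by
            by_cases hab : a ≤ b
            · exact β.mem_kerSystem (β.boundary_mem_kerAt (β.forgetChain_mem hw)) hab
            · rw [eq_bot _ hab, Submodule.mem_bot] at hw
              rw [hw, map_zero]
              exact zero_mem _) = 0,
      (ShortComplex.mk _ _ w).ShortExact := by
  refine shortExact_mapConst _ _ ?_ ?_ ?_ ?_
  · intro a b w _ h
    rw [← β.forgetChain_withNil (X := X) (n + 1) w, h, map_zero]
  · intro a b w hw
    rw [LinearMap.comp_apply, forgetChain_withNil]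
    exact (β.mem_kerAt_succ.1 (β.mem_kerAt_inner hw)).1
  · intro a b w hw h
    by_cases hab : a ≤ b
    · exact ⟨_, β.mem_kerSystem (β.mem_kerAt_of_boundary_eq_zero (β.forgetChain_mem hw) h) hab,
        β.withNil_forgetChain hw⟩
    · rw [eq_bot _ hab, Submodule.mem_bot] at hw
      exact ⟨0, zero_mem _, by rw [hw, map_zero]⟩
  · intro a b w hw
    by_cases hab : a ≤ b
    · obtain ⟨u, hu, rfl⟩ := β.exists_boundary_eq (β.mem_kerAt_inner hw)
      exact ⟨_, β.withNil_mem hab hu, by rw [LinearMap.comp_apply, forgetChain_withNil]⟩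
    · rw [eq_bot _ hab, Submodule.mem_bot] at hw
      exact ⟨0, zero_mem _, by rw [hw, map_zero]⟩

/-! ### Bimodule maps to the regular bimodule as functionals on cycles -/

theorem boundary_single_mem {n : ℕ} {c : (β.stage ⊥ (n + 1)).C} (hc : c ∈ β.innerCycles n) :
    β.boundary n (Finsupp.single c 1) ∈ (β.stage ⊥ n).kerAt (inner (β.endVertex n c)) :=
  β.boundary_mem_kerAt (Finsupp.single_mem_supported k _ (β.inner_endVertex hc).le)

/-- The element of the bimodule given by the boundary of an inner cycle `c`, placed at `(v, v)` for
the end vertex `v` of `c`. -/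
noncomputable def boundaryElement (n : ℕ) (c : (β.stage ⊥ (n + 1)).C) :
    (β.kerSystem n).bimodule :=
  open Classical in
  if hc : c ∈ β.innerCycles n then (β.kerSystem n).single (β.endVertex n c) (β.endVertex n c)
    ⟨β.boundary n (Finsupp.single c 1), β.mem_kerSystem (β.boundary_single_mem hc) le_rfl⟩
  else 0

/-- The functional on `kCⁿ⁺¹` attached to a bimodule map `f` from the `(ker ∂ₙ)_b` to the regular
bimodule: it sends an inner cycle `c` to the value of `f` on `∂ c`. Cycles ending at `y*` go to
zero. -/
noncomputable def functionalOfHom (n : ℕ) (f : (β.kerSystem n).bimodule →ₗ[EnvelopingAlgebra k X]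
    (regular k X).bimodule) : ((β.stage ⊥ (n + 1)).C →₀ k) →ₗ[k] k :=
  Finsupp.linearCombination k fun c =>
    (f (β.boundaryElement n c)).1 (β.endVertex n c) (β.endVertex n c)

variable {β} {n : ℕ} {f : (β.kerSystem n).bimodule →ₗ[EnvelopingAlgebra k X]
    (regular k X).bimodule} {g : X → X → ((β.stage ⊥ n).C →₀ k) →ₗ[k] k}

theorem functionalOfHom_single
    (hg : ∀ a b (m : (β.kerSystem n).bimodule), g a b (m.1 a b) = (f m).1 a b)
    {c : (β.stage ⊥ (n + 1)).C} (hc : c ∈ β.innerCycles n) :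
    β.functionalOfHom n f (Finsupp.single c 1) =
      g (β.endVertex n c) (β.endVertex n c) (β.boundary n (Finsupp.single c 1)) := by
  rw [functionalOfHom, Finsupp.linearCombination_single, one_smul, ← hg, boundaryElement,
    dif_pos hc, coe_single, BiMatrix.single_apply_same]

theorem functionalOfHom_apply
    (hg : ∀ a b (m : (β.kerSystem n).bimodule), g a b (m.1 a b) = (f m).1 a b)
    {a b : X} (hab : a ≤ b) {w : (β.stage ⊥ (n + 1)).C →₀ k}
    (hw : w ∈ Finsupp.supported k k {c | (β.stage ⊥ (n + 1)).top c ≤ inner b}) :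
    β.functionalOfHom n f w = g a b (β.boundary n w) := by
  refine Finsupp.eq_of_mem_supported (g := g a b ∘ₗ β.boundary n) (fun c hc => ?_) hw
  obtain ⟨h₁, h₂⟩ := β.top_le_inner_iff.1 hc
  rw [functionalOfHom_single hg h₁, LinearMap.comp_apply]
  exact (hom_diag_eq (F := fun b => (β.stage ⊥ n).kerAt (inner b)) hg hab h₂
    (β.boundary_single_mem h₁)).symm

theorem functionalOfHom_eq_zero_of_mem_kerPred {w : (β.stage ⊥ (n + 1)).C →₀ k}
    (hw : w ∈ (β.stage ⊥ (n + 1)).kerPred ⊤) : β.functionalOfHom n f w = 0 := by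
  obtain ⟨g, hg⟩ := exists_forall_hom_apply f
  suffices h : (β.stage ⊥ (n + 1)).kerPred ⊤ ≤ LinearMap.ker (β.functionalOfHom n f) from h hw
  refine iSup₂_le fun z hz w hw => ?_
  have hne : z ≠ ⊥ := by
    rintro rfl
    exact hz.2 (bot_lt_inner (Classical.arbitrary X)) (inner_lt_top _)
  obtain ⟨x, rfl⟩ := exists_eq_inner hne hz.lt
  rw [mem_kerAt_succ] at hw
  rw [LinearMap.mem_ker, functionalOfHom_apply hg (le_refl x)
    (β.mem_supported_le hw.2), hw.1, map_zero]

/-- The functional of `f` vanishes on the cycles at `y*` exactly when `f` is given by one functional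
`η` on `kCⁿ`, independent of the vertex. Indeed it then vanishes on all of `(ker ∂ₙ₊₁)_{y*}` and so
factors through `∂ₙ₊₁`. -/
theorem functionalOfHom_eq_zero_iff :
    (∀ w ∈ Submodule.span k (β.basisAt n ⊤), β.functionalOfHom n f w = 0) ↔
      ∃ η : ((β.stage ⊥ n).C →₀ k) →ₗ[k] k, ∀ m a b, η (m.1 a b) = (f m).1 a b := by
  have hB := β.isComplementBasis (n + 1) (β.stage ⊥ (n + 1)) ⊤
  constructor
  · intro h
    obtain ⟨g, hg⟩ := exists_forall_hom_apply f
    obtain ⟨η, hη⟩ := LinearMap.exists_dual_comp_eq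
      (Finsupp.supported k k {c | (β.stage ⊥ (n + 1)).top c < ⊤}) (β.boundary n)
      (β.functionalOfHom n f) fun w hw h0 => by
        have : w ∈ (β.stage ⊥ (n + 1)).kerAt ⊤ := β.mem_kerAt_succ.2 ⟨h0, hw⟩
        rw [← hB.sup_eq] at this
        obtain ⟨w₁, hw₁, w₂, hw₂, rfl⟩ := Submodule.mem_sup.1 this
        rw [map_add, functionalOfHom_eq_zero_of_mem_kerPred hw₁, h w₂ hw₂, add_zero]
    refine ⟨η, fun m a b => ?_⟩
    by_cases hab : a ≤ b
    · obtain ⟨u, hu, hum⟩ := β.exists_boundary_eq (β.mem_kerAt_inner (m.2 a b))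
      rw [← hg, ← hum, ← functionalOfHom_apply hg hab hu]
      exact hη u (Finsupp.supported_mono (fun _ hc => lt_of_le_of_lt hc (inner_lt_top b)) hu)
    · have h₁ := m.2 a b
      have h₂ := (f m).2 a b
      rw [eq_bot _ hab, Submodule.mem_bot] at h₁ h₂
      rw [h₁, h₂, map_zero]
  · rintro ⟨η, hη⟩ w hw
    have hw' : w ∈ (β.stage ⊥ (n + 1)).kerAt ⊤ := by
      rw [← hB.sup_eq]
      exact Submodule.mem_sup_right hw
    rw [mem_kerAt_succ] at hw'
    have := Finsupp.eq_of_mem_supported (f := β.functionalOfHom n f) (g := η ∘ₗ β.boundary n)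
      (fun c hc => functionalOfHom_single (g := fun _ _ => η) (fun a b m => hη m a b) hc) hw'.2
    rw [this, LinearMap.comp_apply, hw'.1, map_zero]

variable (β n) in
/-- Every functional `lam` on the complement of `(ker ∂ₙ₊₁)_{y*⁻}` comes from a bimodule map. Extend
`lam` by zero on `(ker ∂ₙ₊₁)_{y*⁻}`, and then to `kCⁿ⁺¹`; for `b ∈ X` the extension vanishes on
`(ker ∂ₙ₊₁)_b`, so it induces a functional on `(ker ∂ₙ)_b`. -/
theorem exists_functionalOfHom_eq (lam : Submodule.span k (β.basisAt n ⊤) →ₗ[k] k) :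
    ∃ f : (β.kerSystem n).bimodule →ₗ[EnvelopingAlgebra k X] (regular k X).bimodule,
      ∀ w, β.functionalOfHom n f w.1 = lam w := by
  have hB := β.isComplementBasis (n + 1) (β.stage ⊥ (n + 1)) ⊤
  obtain ⟨θ, hθ₁, hμ⟩ := Submodule.exists_dual_extend_of_disjoint hB.disjoint lam
  have (b : X) : ∃ η : ((β.stage ⊥ n).C →₀ k) →ₗ[k] k,
      ∀ w ∈ Finsupp.supported k k {c | (β.stage ⊥ (n + 1)).top c ≤ inner b},
        η (β.boundary n w) = θ w :=
    LinearMap.exists_dual_comp_eq _ _ _ fun w hw h0 =>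
      hθ₁ w (CycleStage.kerAt_le_kerPred _ (inner_lt_top b)
        (β.mem_kerAt_of_boundary_eq_zero hw h0))
  choose g hg using this
  let f := IntervalSystem.map (β.kerSystem n) (regular k X) (fun _ b => g b)
    (fun a b w hw => mem_regular fun h => by
      rw [eq_bot _ h, Submodule.mem_bot] at hw
      rw [hw, map_zero])
    (fun a a' b b' _ _ hb w hw => by
      obtain ⟨u, hu, rfl⟩ := β.exists_boundary_eq (β.mem_kerAt_inner hw)
      rw [hg b u hu, hg b' u (Finsupp.supported_mono
        (fun _ hc => le_trans hc (inner_le_inner.2 hb)) hu)])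
  refine ⟨f, fun w => ?_⟩
  have hw : w.1 ∈ (β.stage ⊥ (n + 1)).kerAt ⊤ := by
    rw [← hB.sup_eq]
    exact Submodule.mem_sup_right w.2
  rw [mem_kerAt_succ] at hw
  refine Eq.trans ?_ (hμ w)
  refine Finsupp.eq_of_mem_supported (f := β.functionalOfHom n f) (g := θ) (fun c hc => ?_) hw.2
  rw [functionalOfHom_single (g := fun _ b => g b) (fun a b m => rfl) hc]
  exact hg _ _ (Finsupp.single_mem_supported k _ (β.inner_endVertex hc).le)

end BasisChoice

noncomputable instance : CategoryTheory.Linear k (ModuleCat.{max u v} (EnvelopingAlgebra k X)) :=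
  ModuleCat.Algebra.instLinear

namespace IntervalSystem

variable {V : Type (max u v)} [AddCommGroup V] [Module k V]

/-- The bimodule of an interval system as an object of the module category. -/
noncomputable abbrev toModuleCat (E : IntervalSystem k X V) :
    ModuleCat.{max u v} (EnvelopingAlgebra k X) :=
  ModuleCat.of (EnvelopingAlgebra k X) E.bimodule

variable (k X) in
/-- The regular bimodule, as a bimodule of matrices, as an object of the module category. -/
noncomputable abbrev regularModule : ModuleCat.{max u v} (EnvelopingAlgebra k X) :=
  ModuleCat.of (EnvelopingAlgebra k X) (regular k X).bimodule

/-- The space of bimodule maps to the regular bimodule. A separate name for this hom type lets the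
`k`-module structure be found by instance search. -/
def HomRegular (E : IntervalSystem k X V) : Type (max u v) := E.toModuleCat ⟶ regularModule k X

noncomputable instance (E : IntervalSystem k X V) : AddCommGroup E.HomRegular :=
  inferInstanceAs (AddCommGroup (E.toModuleCat ⟶ regularModule k X))

noncomputable instance (E : IntervalSystem k X V) : Module k E.HomRegular :=
  CategoryTheory.Linear.homModule E.toModuleCat (regularModule k X)

theorem smul_hom_apply {E : IntervalSystem k X V} (r : k) (φ : E.HomRegular)
    (m : E.bimodule) (a b : X) : ((r • φ).hom m).1 a b = r * (φ.hom m).1 a b := by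
  change ((algebraMap k (EnvelopingAlgebra k X) r) • (φ.hom m).1) a b = _
  rw [algebraMap_smul]
  rfl

end IntervalSystem

namespace BasisChoice

open IntervalSystem ChainComplexOver

variable [Nonempty X] (β : BasisChoice k (StarPoset X))

theorem finrank_dual_span_basisAt (n : ℕ) (z : StarPoset X) :
    Module.finrank k (Module.Dual k (Submodule.span k (β.basisAt n z))) =
      (β.cyclesAt ⊥ (n + 2) z).ncard :=
  (finrank_dual_submodule _).trans (β.finrank_span_basisAt n z)

/-- The restriction of the functional of a bimodule map to the span of the basis chosen at `y*`. -/
noncomputable def homToDual (n : ℕ) : (β.kerSystem n).HomRegular →ₗ[k]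
    Module.Dual k (Submodule.span k (β.basisAt n ⊤)) where
  toFun φ := (β.functionalOfHom n φ.hom).domRestrict _
  map_add' φ ψ := by
    have : β.functionalOfHom n (φ + ψ).hom =
        β.functionalOfHom n φ.hom + β.functionalOfHom n ψ.hom := by
      refine Finsupp.lhom_ext' fun c => LinearMap.ext_ring ?_
      simp only [functionalOfHom, LinearMap.comp_apply, Finsupp.lsingle_apply, LinearMap.add_apply,
        Finsupp.linearCombination_single, one_smul]
      rfl
    rw [this]
    rfl
  map_smul' r φ := by
    have : β.functionalOfHom n (r • φ).hom = r • β.functionalOfHom n φ.hom := by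
      refine Finsupp.lhom_ext' fun c => LinearMap.ext_ring ?_
      simp only [functionalOfHom, LinearMap.comp_apply, Finsupp.lsingle_apply,
        LinearMap.smul_apply, Finsupp.linearCombination_single, one_smul]
      exact smul_hom_apply r φ _ _ _
    rw [this]
    rfl

theorem homToDual_surjective (n : ℕ) : Function.Surjective (β.homToDual n) := fun lam => by
  obtain ⟨f, hf⟩ := β.exists_functionalOfHom_eq n lam
  exact ⟨ModuleCat.ofHom f, LinearMap.ext hf⟩

theorem homToDual_eq_zero_iff {n : ℕ} {φ : (β.kerSystem n).HomRegular} :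
    β.homToDual n φ = 0 ↔
      ∃ η : ((β.stage ⊥ n).C →₀ k) →ₗ[k] k, ∀ m a b, η (m.1 a b) = (φ.hom m).1 a b := by
  rw [← functionalOfHom_eq_zero_iff]
  exact ⟨fun h w hw => LinearMap.congr_fun h ⟨w, hw⟩, fun h => LinearMap.ext fun w => h w.1 w.2⟩

/-! ### The cohomology in positive degrees and in degree zero -/

/-- Both sides are quotients of the space of bimodule maps from the `(ker ∂ₙ₊₁)_b` to the regular
bimodule, by the maps given by one functional on `kCⁿ⁺¹`. -/
theorem nonempty_ext_equiv (n : ℕ) :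
    Nonempty (Abelian.Ext.{max u v} (β.kerSystem 0).toModuleCat (regularModule k X) (n + 1) ≃ₗ[k]
      Module.Dual k (Submodule.span k (β.basisAt (n + 1) ⊤))) := by
  choose w hw using β.shortExact
  obtain ⟨δ, hδ, hδ'⟩ := exists_linearMap_ext_of_acyclic (R := k) (N := regularModule k X) n
    (fun n => (β.kerSystem n).toModuleCat) (fun n => (β.cycleModule n).toModuleCat) _ _ w hw
    (fun n j => subsingleton_ext j)
  refine LinearMap.nonempty_quotKer_equiv (V := (β.kerSystem (n + 1)).HomRegular) (f := δ) hδ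
    (β.homToDual_surjective (n + 1)) fun φ => ?_
  refine (hδ' φ).trans (Iff.trans ?_ β.homToDual_eq_zero_iff.symm)
  constructor
  · rintro ⟨ψ, rfl⟩
    obtain ⟨g, hg⟩ := exists_forall_hom_apply ψ.hom
    -- a map on the bimodule of cycles has only one value on each cycle, the one at its end vertex
    refine ⟨Finsupp.linearCombination k fun c =>
      g (β.endVertex n c) (β.endVertex n c) (Finsupp.single (c, []) 1), fun m a b => ?_⟩
    have hm := m.2 a b
    refine Eq.trans ?_ (hg a b _)
    change _ = g a b (β.withNil (n + 1) (m.1 a b))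
    by_cases hab : a ≤ b
    · refine Finsupp.eq_of_mem_supported (g := g a b ∘ₗ β.withNil (n + 1)) (fun c hc => ?_)
        (β.mem_supported_le (β.mem_kerAt_succ.1 (β.mem_kerAt_inner hm)).2)
      obtain ⟨h₁, h₂⟩ := β.top_le_inner_iff.1 hc
      have hmem {a' b' : X} (h : a' ≤ b') (hb : β.endVertex n c ≤ b') :
          Finsupp.single (c, []) 1 ∈ (β.cycleModule n).carrier a' b' := by
        rw [← withNil_single]
        exact β.withNil_mem h
          (Finsupp.single_mem_supported k _ (β.top_le_inner_iff.2 ⟨h₁, hb⟩))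
      rw [LinearMap.comp_apply, withNil_single, Finsupp.linearCombination_single, one_smul,
        hom_compat hg hab le_rfl (hmem le_rfl h₂), ← hom_compat hg h₂ le_rfl (hmem le_rfl h₂),
        hom_compat hg le_rfl h₂ (hmem le_rfl le_rfl)]
    · rw [eq_bot _ hab, Submodule.mem_bot] at hm
      simp [hm]
  · rintro ⟨η, hη⟩
    refine ⟨ModuleCat.ofHom ((β.cycleModule n).functional (η ∘ₗ β.forgetChain (n + 1))), ?_⟩
    ext m a b
    refine Eq.trans ?_ (hη m a b)
    exact congrArg η (β.forgetChain_withNil (n + 1) (m.1 a b))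

section DegreeZero

/-- The only element `x*` of `C⁰`. -/
def baseCycle : (β.stage ⊥ 0).C := ⟨⊥, rfl⟩

theorem eq_smul_baseCycle (w : (β.stage ⊥ 0).C →₀ k) :
    w = w β.baseCycle • Finsupp.single β.baseCycle 1 := by
  ext c
  have : c = β.baseCycle := Subsingleton.elim (α := (CycleStage.initial k (⊥ : StarPoset X)).C) _ _
  rw [this]
  simp

theorem mem_kerAt_zero (b : X) (w : (β.stage ⊥ 0).C →₀ k) : w ∈ (β.stage ⊥ 0).kerAt (inner b) := by
  refine ⟨rfl, fun c _ => ?_⟩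
  have : (β.stage ⊥ 0).top c = ⊥ := c.down.2
  rw [Set.mem_ofPred_eq, this]
  exact bot_lt_inner b

/-- The coefficient of `x*`, an isomorphism from `kC⁰` to `k`. -/
noncomputable def coeffBaseCycle : ((β.stage ⊥ 0).C →₀ k) →ₗ[k] k :=
  Finsupp.lapply β.baseCycle

/-- In degree `0` every `(ker ∂₀)_b` is `kC⁰`, so their bimodule is the regular one. -/
noncomputable def kerSystemZeroIso : (β.kerSystem 0).toModuleCat ≅ regularModule k X :=
  LinearEquiv.toModuleIso <| LinearEquiv.ofBijective
    ((β.kerSystem 0).functional β.coeffBaseCycle) <| by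
    constructor
    · refine (injective_iff_map_eq_zero _).2 fun m hm => bimodule_ext fun a b => ?_
      have : β.coeffBaseCycle (m.1 a b) = 0 := congrFun₂ (congrArg Subtype.val hm) a b
      rw [β.eq_smul_baseCycle (m.1 a b)]
      change β.coeffBaseCycle (m.1 a b) • Finsupp.single β.baseCycle (1 : k) = 0
      rw [this, zero_smul]
    · intro m
      refine ⟨⟨fun a b => m.1 a b • Finsupp.single β.baseCycle (1 : k), fun a b => ?_⟩, ?_⟩
      · by_cases hab : a ≤ b
        · exact β.mem_kerSystem (β.mem_kerAt_zero b _) hab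
        · have := m.2 a b
          rw [eq_bot _ hab, Submodule.mem_bot] at this
          change m.1 a b • Finsupp.single β.baseCycle (1 : k) ∈ _
          rw [this, zero_smul]
          exact zero_mem _
      · ext a b
        change β.coeffBaseCycle (m.1 a b • Finsupp.single β.baseCycle (1 : k)) = m.1 a b
        simp [coeffBaseCycle]

theorem single_baseCycle_mem (b : X) :
    Finsupp.single β.baseCycle 1 ∈ (β.kerSystem 0).carrier b b :=
  β.mem_kerSystem (β.mem_kerAt_zero b _) le_rfl

/-- The values of an endomorphism of the regular bimodule at the idempotents `c_{b,b}`. -/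
noncomputable def evalVertex :
    (β.kerSystem 0).HomRegular →ₗ[k] (X → k) where
  toFun φ b := (φ.hom ((β.kerSystem 0).single b b ⟨_, β.single_baseCycle_mem b⟩)).1 b b
  map_add' _ _ := rfl
  map_smul' r φ := funext fun b => smul_hom_apply r φ _ b b

theorem hom_apply_eq (φ : (β.kerSystem 0).HomRegular)
    (m : (β.kerSystem 0).bimodule) (a b : X) :
    (φ.hom m).1 a b = β.coeffBaseCycle (m.1 a b) * β.evalVertex φ b := by
  obtain ⟨g, hg⟩ := exists_forall_hom_apply φ.hom
  by_cases hab : a ≤ b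
  · have h₁ : β.evalVertex φ b = g b b (Finsupp.single β.baseCycle 1) := by
      change (φ.hom _).1 b b = _
      rw [← hg, coe_single, BiMatrix.single_apply_same]
    have h₂ := hom_diag_eq (F := fun b => (β.stage ⊥ 0).kerAt (inner b))
      (hF := β.kerAt_inner_mono 0) hg hab le_rfl
      (β.mem_kerAt_zero b (Finsupp.single β.baseCycle 1))
    rw [← hg, h₁, ← h₂, ← smul_eq_mul, ← map_smul]
    exact congrArg (g a b) (β.eq_smul_baseCycle _)
  · have h₁ := m.2 a b
    have h₂ := (φ.hom m).2 a b
    rw [eq_bot _ hab, Submodule.mem_bot] at h₁ h₂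
    rw [h₁, h₂, map_zero, zero_mul]

theorem evalVertex_eq_of_le (φ : (β.kerSystem 0).HomRegular) {a b : X}
    (h : a ≤ b) : β.evalVertex φ a = β.evalVertex φ b := by
  have h₁ := hom_single_compat φ.hom (le_refl a) h _ (β.single_baseCycle_mem a)
  rw [hom_apply_eq, hom_apply_eq] at h₁
  simpa [coe_single, coeffBaseCycle] using h₁.symm

theorem evalVertex_injective : Function.Injective β.evalVertex := by
  refine (injective_iff_map_eq_zero _).2 fun φ hφ => ?_
  refine ModuleCat.hom_ext (LinearMap.ext fun m => bimodule_ext fun a b => ?_)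
  change (φ.hom m).1 a b = 0
  rw [hom_apply_eq, hφ, Pi.zero_apply, mul_zero]

variable (X) in
theorem eq_of_reachable {u : X → k} (hu : ∀ a b, a ≤ b → u a = u b) {a b : X}
    (h : (SimpleGraph.hasse X).Reachable a b) : u a = u b := by
  obtain ⟨p⟩ := h
  induction p with
  | nil => rfl
  | cons hadj _ ih =>
    rw [← ih]
    rcases SimpleGraph.hasse_adj.1 hadj with h | h
    · exact hu _ _ h.le
    · exact (hu _ _ h.le).symm

theorem reachable_of_le {a b : X} (h : a ≤ b) : (SimpleGraph.hasse X).Reachable a b := by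
  induction a using WellFoundedGT.induction with
  | ind a ih =>
    rcases h.eq_or_lt with rfl | hlt
    · exact SimpleGraph.Reachable.refl _
    · obtain ⟨c, hac, hcb⟩ := exists_covBy_le_of_lt hlt
      exact (SimpleGraph.Adj.reachable (SimpleGraph.hasse_adj.2 (Or.inl hac))).trans
        (ih c hac.lt hcb)

/-- Endomorphisms of the regular bimodule are functions on `X` that are constant along the order. -/
theorem nonempty_hom_equiv_components :
    Nonempty ((β.kerSystem 0).HomRegular ≃ₗ[k]
      ((SimpleGraph.hasse X).ConnectedComponent → k)) := by
  let L : ((SimpleGraph.hasse X).ConnectedComponent → k) →ₗ[k] (X → k) :=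
    LinearMap.funLeft k k (SimpleGraph.hasse X).connectedComponentMk
  have hL : Function.Injective L :=
    LinearMap.funLeft_injective_of_surjective k k _ Quot.mk_surjective
  have hrange : LinearMap.range β.evalVertex = LinearMap.range L := by
    apply le_antisymm
    · rintro _ ⟨φ, rfl⟩
      refine ⟨fun c => c.lift (β.evalVertex φ) fun _ _ p _ =>
        eq_of_reachable X (fun a b => β.evalVertex_eq_of_le φ) p.reachable, rfl⟩
    · rintro _ ⟨u, rfl⟩
      refine ⟨ModuleCat.ofHom (IntervalSystem.map (β.kerSystem 0) (regular k X)
        (fun _ b => L u b • β.coeffBaseCycle) (fun a b w hw => mem_regular fun h => ?_)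
        (fun a a' b b' _ _ hb w _ => ?_)), ?_⟩
      · rw [eq_bot _ h, Submodule.mem_bot] at hw
        rw [hw, map_zero]
      · have : L u b' = L u b := congrArg u
          (SimpleGraph.ConnectedComponent.eq.2 (reachable_of_le hb).symm)
        rw [this]
      · funext b
        change L u b • β.coeffBaseCycle (BiMatrix.single b b (Finsupp.single β.baseCycle 1) b b) = _
        simp [coeffBaseCycle]
  exact ⟨(LinearEquiv.ofInjective _ β.evalVertex_injective) ≪≫ₗ LinearEquiv.ofEq _ _ hrange ≪≫ₗ
    (LinearEquiv.ofInjective _ hL).symm⟩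

/-- The kernel of the map to the dual is spanned by the identity, since `kC⁰` is one-dimensional. -/
theorem finrank_hom_zero :
    Module.finrank k (β.kerSystem 0).HomRegular =
      (β.cyclesAt ⊥ 2 ⊤).ncard + 1 := by
  obtain ⟨e⟩ := β.nonempty_hom_equiv_components
  have : Finite (SimpleGraph.hasse X).ConnectedComponent := Quot.finite _
  have := Fintype.ofFinite (SimpleGraph.hasse X).ConnectedComponent
  have : Module.Finite k (β.kerSystem 0).HomRegular :=
    Module.Finite.equiv e.symm
  have h := LinearMap.finrank_range_add_finrank_ker (β.homToDual 0)
  rw [LinearMap.range_eq_top.2 (β.homToDual_surjective 0), finrank_top,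
    finrank_dual_span_basisAt] at h
  rw [← h]
  congr 1
  let φ₀ : (β.kerSystem 0).HomRegular :=
    ModuleCat.ofHom ((β.kerSystem 0).functional β.coeffBaseCycle)
  have hφ₀ (b : X) : β.evalVertex φ₀ b = 1 := by
    change β.coeffBaseCycle (BiMatrix.single b b (Finsupp.single β.baseCycle 1) b b) = 1
    simp [coeffBaseCycle]
  refine finrank_eq_one (⟨φ₀, ?_⟩ : LinearMap.ker (β.homToDual 0)) ?_ ?_
  · exact β.homToDual_eq_zero_iff.2 ⟨β.coeffBaseCycle, fun _ _ _ => rfl⟩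
  · intro h0
    have : β.evalVertex φ₀ (Classical.arbitrary X) = 0 := by
      rw [show φ₀ = 0 from congrArg Subtype.val h0, map_zero, Pi.zero_apply]
    rw [hφ₀] at this
    exact one_ne_zero this
  · rintro ⟨φ, hφ⟩
    obtain ⟨η, hη⟩ := β.homToDual_eq_zero_iff.1 hφ
    refine ⟨η (Finsupp.single β.baseCycle 1), Subtype.ext (β.evalVertex_injective ?_)⟩
    funext b
    rw [Submodule.coe_smul, map_smul, Pi.smul_apply, hφ₀, smul_eq_mul, mul_one]
    have := hη ((β.kerSystem 0).single b b ⟨_, β.single_baseCycle_mem b⟩) b b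
    rwa [coe_single, BiMatrix.single_apply_same] at this

end DegreeZero

end BasisChoice

end CyclesToCohomology

theorem theorem3p2 (k : Type u) [Field k] (X : Type v) [PartialOrder X] [Finite X] [Nonempty X]
    [LocallyFiniteOrder X] [DecidableEq X] (β : BasisChoice k (StarPoset X)) :
    (∀ i : ℕ, Module.Finite k (HochschildCohomology.{u, v} k (IncidenceAlgebra k X) i) ∧
      (β.cyclesAt ⊥ (i + 2) ⊤).Finite) ∧
    Module.finrank k (HochschildCohomology.{u, v} k (IncidenceAlgebra k X) 0) =
      (β.cyclesAt ⊥ 2 ⊤).ncard + 1 ∧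
    (β.cyclesAt ⊥ 2 ⊤).ncard + 1 = Nat.card (SimpleGraph.hasse X).ConnectedComponent ∧
    ∀ i : ℕ, 0 < i →
      Module.finrank k (HochschildCohomology.{u, v} k (IncidenceAlgebra k X) i) =
        (β.cyclesAt ⊥ (i + 2) ⊤).ncard := by
  have := Fintype.ofFinite X
  have hiso (i : ℕ) : Nonempty (HochschildCohomology.{u, v} k (IncidenceAlgebra k X) i ≃ₗ[k]
      CategoryTheory.Abelian.Ext.{max u v} (β.kerSystem 0).toModuleCat
        (IntervalSystem.regularModule k X) i) :=
    CategoryTheory.Abelian.Ext.nonempty_linearEquiv_of_iso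
      ((regularBimoduleIso k X).symm ≪≫ β.kerSystemZeroIso.symm) (regularBimoduleIso k X).symm i
  have hpos (i : ℕ) : Nonempty (HochschildCohomology.{u, v} k (IncidenceAlgebra k X) (i + 1) ≃ₗ[k]
      Module.Dual k (Submodule.span k (β.basisAt (i + 1) ⊤))) := by
    obtain ⟨e⟩ := hiso (i + 1)
    obtain ⟨e'⟩ := β.nonempty_ext_equiv i
    exact ⟨e ≪≫ₗ e'⟩
  have hzero : Nonempty (HochschildCohomology.{u, v} k (IncidenceAlgebra k X) 0 ≃ₗ[k]
      (β.kerSystem 0).HomRegular) := by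
    obtain ⟨e⟩ := hiso 0
    exact ⟨e ≪≫ₗ CategoryTheory.Abelian.Ext.linearEquiv₀⟩
  obtain ⟨e₀⟩ := hzero
  obtain ⟨e₁⟩ := β.nonempty_hom_equiv_components
  have : Finite (SimpleGraph.hasse X).ConnectedComponent := Quot.finite _
  have := Fintype.ofFinite (SimpleGraph.hasse X).ConnectedComponent
  refine ⟨fun i => ⟨?_, β.finite_cyclesAt _ _⟩, ?_, ?_, fun i hi => ?_⟩
  · cases i with
    | zero => exact Module.Finite.equiv (e₀ ≪≫ₗ e₁).symm
    | succ i =>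
      obtain ⟨e⟩ := hpos i
      have := β.finite_stage (i + 2)
      exact Module.Finite.equiv e.symm
  · rw [e₀.finrank_eq, β.finrank_hom_zero]
  · rw [← β.finrank_hom_zero, e₁.finrank_eq, Module.finrank_fintype_fun_eq_card,
      Nat.card_eq_fintype_card]
  · obtain ⟨i, rfl⟩ := Nat.exists_eq_succ_of_ne_zero hi.ne'
    obtain ⟨e⟩ := hpos i
    rw [e.finrank_eq]
    exact β.finrank_dual_span_basisAt (i + 1) ⊤
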